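/- Let $M_{\kappa,\mu}(z)=e^{-z/2}z^{1/2+\mu}\sum_{s\ge 0}\frac{(\frac12+\mu-\kappa)_s}{(1+2\mu)_s\,s!}z^s$ be the Whittaker $M$-function. For $\gamma>0$ and $E\in\mathbb R$ consider on the cylinder $[-\frac{\pi}{2},\frac{\pi}{2}]\times(\mathbb{R}/2\pi\mathbb{Z})$ the dynamical system $$\dot z=\cos^2 z,\qquad \dot\Theta=2\cos\Theta-\gamma e^{-|\tan z|}-2E,$$ where $e^{-|\tan z|}$ is extended by $0$ to $z=\pm\frac{\pi}{2}$. A heteroclinic orbit is an orbit on the cylinder that converges as $\tau\to-\infty$ and as $\tau\to+\infty$ to two distinct equilibrium points. Its winding number is $\left\lfloor\frac{\Theta(-\infty)-\Theta(\infty)}{2\pi}\right\rfloor$, where $\Theta(\pm\infty)$ are the limits of $\Theta$ along a lift of the orbit to $[-\frac{\pi}{2},\frac{\pi}{2}]\times\mathbb{R}$. An orbit is called symmetric if it is invariant under the reflection $(z,\Theta)\mapsto(-z,-\Theta)$. **Theorem.** There is a strictly increasing sequence $0=\Gamma_0<\Gamma_1<\Gamma_2<\cdots$ with $\Gamma_j\to\infty$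 such that, for all $k\ge 1$, $\Gamma_{2k-1}$ is the $k$-th positive root of $r\mapsto M'_{i,1/2}(ir)$ and $\Gamma_{2k}$ is the $k$-th positive root of $r\mapsto M_{i,1/2}(ir)$ (all positive roots being listed), and such that the following holds for $E=-1$. If $\gamma>0$ and $\gamma\in[\Gamma_{j-1},\Gamma_j)$ for some integer $j\ge 1$, then 1. the set of winding numbers of all heteroclinic orbits of the system is exactly $\{j-2,\,j-1\}$; and 2. there are exactly two symmetric heteroclinic orbits of the system, one with winding number $j-2$ and the other with winding number $j-1$. -/

import Mathlib

open Filter Topology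

noncomputable section

/-! ### Whittaker functions -/

/-- Kummer's confluent hypergeometric function `M(a, b, z) = ∑ₛ (a)ₛ / ((b)ₛ s!) zˢ`, for `b` not a
non-positive integer (see `kummerM_eq_tsum`). -/
def kummerM (a b z : ℂ) : ℂ :=
  Complex.Gamma b * Complex.regularizedHGFun {a} {b} z

/-- The Whittaker function
`M_{κ,μ}(z) = e^{-z/2} z^{1/2+μ} M(1/2 + μ - κ, 1 + 2μ, z)`. -/
def whittakerM (κ μ z : ℂ) : ℂ :=
  Complex.exp (-z / 2) * z ^ (1 / 2 + μ) * kummerM (1 / 2 + μ - κ) (1 + 2 * μ) z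

theorem kummerM_eq_tsum (a b z : ℂ) (hb : ∀ k : ℕ, b ≠ -k) :
    kummerM a b z = ∑' s : ℕ, (ascPochhammer ℂ s).eval a /
      ((ascPochhammer ℂ s).eval b * (s.factorial : ℂ)) * z ^ s := by
  have h0 : Complex.Gamma b ≠ 0 := Complex.Gamma_ne_zero hb
  rw [kummerM, Complex.regularizedHGFun, FormalMultilinearSeries.sum, ← tsum_mul_left]
  refine tsum_congr fun s => ?_
  rw [FormalMultilinearSeries.apply_eq_pow_smul_coeff, Complex.regularizedHGFunSeries_coeff,
    Complex.regularizedHGFunCoeff, ← Complex.Gamma_add_nat_div_Gamma_eq b hb]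
  simp only [Multiset.map_singleton, Multiset.prod_singleton, smul_eq_mul]
  field_simp

/-- `Γ₀ = 0`, and `Γ₀ < Γ₁ < Γ₂ < ⋯` is such that, for `j = 1, 2, 3, …`, `Γ_{2j-1}` is the `j`-th
positive root of `r ↦ M'_{i,1/2}(ir)` and `Γ_{2j}` is the `j`-th positive root of
`r ↦ M_{i,1/2}(ir)`. The odd and the even terms enumerate *all* positive roots. -/
structure IsWhittakerSequence (Γ : ℕ → ℝ) : Prop where
  zero : Γ 0 = 0
  strictMono : StrictMono Γ
  critical_points : Set.range (fun k : ℕ => Γ (2 * k + 1)) =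
    {r : ℝ | 0 < r ∧ deriv (whittakerM Complex.I (1 / 2)) (Complex.I * r) = 0}
  zeros : Set.range (fun k : ℕ => Γ (2 * k + 2)) =
    {r : ℝ | 0 < r ∧ whittakerM Complex.I (1 / 2) (Complex.I * r) = 0}

/-! ### The dynamical system on the cylinder `[-π/2, π/2] × ℝ/2πℤ` -/

/-- The function `exp(-|tan z|)`, extended continuously by `0` to `z = ±π/2`. -/
def screening (z : ℝ) : ℝ :=
  if Real.cos z = 0 then 0 else Real.exp (-|Real.tan z|)

/-- The vector field `(z, Θ) ↦ (cos² z, 2 cos Θ - γ exp(-|tan z|) - 2E)` on the universal cover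
`[-π/2, π/2] × ℝ` of the cylinder. -/
def vectorField (E γ : ℝ) (p : ℝ × ℝ) : ℝ × ℝ :=
  (Real.cos p.1 ^ 2, 2 * Real.cos p.2 - γ * screening p.1 - 2 * E)

/-- The strip `[-π/2, π/2] × ℝ`. -/
def strip : Set (ℝ × ℝ) := Set.Icc (-(Real.pi / 2)) (Real.pi / 2) ×ˢ Set.univ

/-- The covering map from the strip to the cylinder. -/
def toCylinder (p : ℝ × ℝ) : ℝ × Real.Angle := (p.1, (p.2 : Real.Angle))

/-- A complete trajectory of the system, lifted to the strip. -/
def IsTrajectory (E γ : ℝ) (x : ℝ → ℝ × ℝ) : Prop :=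
  ∀ τ : ℝ, x τ ∈ strip ∧ HasDerivAt x (vectorField E γ (x τ)) τ

/-- An equilibrium point of the system, lifted to the strip. -/
def IsEquilibrium (E γ : ℝ) (p : ℝ × ℝ) : Prop :=
  p ∈ strip ∧ vectorField E γ p = 0

/-- A trajectory connecting two equilibrium points that are distinct as points of the cylinder. -/
def IsHeteroclinicTrajectory (E γ : ℝ) (x : ℝ → ℝ × ℝ) : Prop :=
  IsTrajectory E γ x ∧ ∃ p q : ℝ × ℝ,
    IsEquilibrium E γ p ∧ IsEquilibrium E γ q ∧ toCylinder p ≠ toCylinder q ∧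
    Tendsto x atBot (𝓝 p) ∧ Tendsto x atTop (𝓝 q)

/-- The orbit on the cylinder that a lifted trajectory traces. -/
def orbitOf (x : ℝ → ℝ × ℝ) : Set (ℝ × Real.Angle) :=
  Set.range fun τ => toCylinder (x τ)

/-- A heteroclinic orbit of the system on the cylinder. -/
def IsHeteroclinicOrbit (E γ : ℝ) (O : Set (ℝ × Real.Angle)) : Prop :=
  ∃ x : ℝ → ℝ × ℝ, IsHeteroclinicTrajectory E γ x ∧ O = orbitOf x

/-- `O` is a heteroclinic orbit with winding number
`N = ⌊(Θ(-∞) - Θ(∞)) / 2π⌋`, where `Θ` is the angle along a lift of `O` to the strip. -/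
def HasWindingNumber (E γ : ℝ) (O : Set (ℝ × Real.Angle)) (N : ℤ) : Prop :=
  ∃ x : ℝ → ℝ × ℝ, IsHeteroclinicTrajectory E γ x ∧ O = orbitOf x ∧
    ∃ θm θp : ℝ, Tendsto (fun τ => (x τ).2) atBot (𝓝 θm) ∧
      Tendsto (fun τ => (x τ).2) atTop (𝓝 θp) ∧
      N = ⌊(θm - θp) / (2 * Real.pi)⌋

/-- `O` is mapped to itself by the reflection `(z, Θ) ↦ (-z, -Θ)` of the cylinder. -/
def IsSymmetricOrbit (O : Set (ℝ × Real.Angle)) : Prop :=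
  (fun p : ℝ × Real.Angle => (-p.1, -p.2)) '' O = O

end

/-!
In the interior of the strip `tan z` is time up to a shift, so with `t = tan z` and `Θ = π + φ` the
system at `E = -1` becomes the scalar phase equation `φ' = 2 - 2 cos φ - γ e^{-|t|}`. Each boundary
circle carries one equilibrium, `Θ = π`; hence heteroclinic trajectories are exactly the interior
ones (`IsHeteroclinicTrajectory.exists_phase`, `isHeteroclinicTrajectory_phaseLift`), and an orbit
is determined by `φ(0)` modulo `2π`.

For `t ≥ 0` the substitution `r = γ e^{-t}` reduces everything to `φ' = 2 - 2 cos φ - e^{-t}`.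
Solutions of this equation that stay bounded converge to multiples of `2π`, generically from below.
One solution `A`, positive and tending to `0`, separates those that converge to `0` from those that
converge to `2π` (`tendsto_zero_of_phase_between`). Therefore `φ(∞) = 2π ⌈(φ(0) - a) / 2π⌉` with
`a = A(-log γ)`, and the reflection `φ(t) ↦ -φ(-t)` gives `φ(-∞) = 2π ⌊(φ(0) + a) / 2π⌋`. With
`s = φ(0) / 2π` and `α = a / 2π` the winding number is `⌊s + α⌋ - ⌈s - α⌉`, one less than the number
of integers in an interval of length `2α`. It is `j - 2` or `j - 1` when `2α ∈ [j - 1, j)`. The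
symmetric orbits are those with `φ(0) ∈ {0, π}`; their winding numbers are even and odd
respectively, so both values occur.

The equation is the Prüfer form of a linear system: `A / 2` is the polar angle of `(v, 2v')` at
`r = e^{-t}`, where `v'' = (1 / r - 1 / 4) v`, `v(0) = 0`, `v'(0) = 1`
(`IsCoulombPair.exists_isSeparatrix`). By Whittaker's equation, `M_{i,1/2}(ir) = i v(r)`: real and
imaginary parts of `-i M_{i,1/2}(ir)` have vanishing Wronskian, which is enough to identify its zeros
and critical points with those of `v`. So the roots are the points where `A` is a multiple of `π`.
For `r ≤ 4` the product `v v'` is positive and `A` stays in `(0, π)`; for `r > 4` the angle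
increases strictly with `r`, to infinity. Hence `A` passes every positive multiple of `π` exactly
once, at `r = Γ_k` for `k π`, and `γ ∈ [Γ_{j-1}, Γ_j)` means `2α = a / π ∈ [j - 1, j)`.
-/

/-! ### The Whittaker function on the imaginary axis -/

/-- Termwise differentiation of an everywhere convergent power series. -/
theorem HasFPowerSeriesOnBall.hasSum_deriv_of_top {f : ℂ → ℂ}
    {p : FormalMultilinearSeries ℂ ℂ ℂ} (h : HasFPowerSeriesOnBall f p 0 ⊤) (z : ℂ) :
    HasSum (fun n : ℕ => ((n : ℂ) + 1) * p.coeff (n + 1) * z ^ n) (deriv f z) := by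
  have h1 := h.fderiv.hasSum (y := z) (by simp)
  have h2 := h1.mapL (ContinuousLinearMap.apply ℂ ℂ (1 : ℂ))
  simp only [zero_add, ContinuousLinearMap.apply_apply, fderiv_apply_one_eq_deriv] at h2
  refine h2.congr_fun fun n => ?_
  rw [FormalMultilinearSeries.apply_eq_pow_smul_coeff, smul_apply,
    FormalMultilinearSeries.derivSeries_coeff_one]
  simp only [nsmul_eq_mul, smul_eq_mul]
  push_cast
  ring

theorem HasSum.mul_pow_shift {c : ℕ → ℂ} {z S : ℂ}
    (h : HasSum (fun n : ℕ => ((n : ℂ) + 1) * c (n + 1) * z ^ n) S) :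
    HasSum (fun n : ℕ => (n : ℂ) * c n * z ^ n) (z * S) := by
  have h1 : HasSum (fun n : ℕ => ((n + 1 : ℕ) : ℂ) * c (n + 1) * z ^ (n + 1)) (z * S) :=
    (h.mul_left z).congr_fun fun n => by push_cast; ring
  simpa using (hasSum_nat_add_iff (f := fun n : ℕ => (n : ℂ) * c n * z ^ n) 1).1 h1

/-- The regularized Kummer function `M(a, b, z) / Γ(b)`. -/
noncomputable def kummerReg (a b : ℂ) : ℂ → ℂ := Complex.regularizedHGFun {a} {b}

theorem hasFPowerSeriesOnBall_kummerReg (a b : ℂ) :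
    HasFPowerSeriesOnBall (kummerReg a b) (Complex.regularizedHGFunSeries {a} {b}) 0 ⊤ := by
  have hr : (Complex.regularizedHGFunSeries {a} {b}).radius = ⊤ :=
    Complex.radius_regularizedHGFunSeries_eq_top (by simp)
  have := (Complex.regularizedHGFunSeries {a} {b}).hasFPowerSeriesOnBall (by simp [hr])
  rwa [hr] at this

theorem hasSum_kummerReg (a b z : ℂ) :
    HasSum (fun n : ℕ => Complex.regularizedHGFunCoeff {a} {b} n * z ^ n) (kummerReg a b z) := by
  have := (hasFPowerSeriesOnBall_kummerReg a b).hasSum (y := z) (by simp)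
  rw [zero_add] at this
  refine this.congr_fun fun n => ?_
  rw [FormalMultilinearSeries.apply_eq_pow_smul_coeff, Complex.regularizedHGFunSeries_coeff,
    smul_eq_mul, mul_comm]

theorem differentiable_kummerReg (a b : ℂ) : Differentiable ℂ (kummerReg a b) := fun z =>
  ((hasFPowerSeriesOnBall_kummerReg a b).analyticAt_of_mem (by simp)).differentiableAt

theorem hasSum_deriv_kummerReg (a b z : ℂ) :
    HasSum (fun n : ℕ => ((n : ℂ) + 1) * Complex.regularizedHGFunCoeff {a} {b} (n + 1) * z ^ n)
      (deriv (kummerReg a b) z) := by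
  simpa using (hasFPowerSeriesOnBall_kummerReg a b).hasSum_deriv_of_top z

theorem succ_mul_regularizedHGFunCoeff (a b : ℂ) (n : ℕ) :
    ((n : ℂ) + 1) * Complex.regularizedHGFunCoeff {a} {b} (n + 1) =
      a * Complex.regularizedHGFunCoeff {a + 1} {b + 1} n := by
  have h : (n.factorial : ℂ) ≠ 0 := by exact_mod_cast n.factorial_ne_zero
  have h' : ((n : ℂ) + 1) ≠ 0 := by exact_mod_cast n.succ_ne_zero
  simp only [Complex.regularizedHGFunCoeff, Multiset.map_singleton, Multiset.prod_singleton,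
    ascPochhammer_succ_left, Nat.factorial_succ, Polynomial.eval_mul, Polynomial.eval_X,
    Polynomial.eval_comp, Polynomial.eval_add, Polynomial.eval_one]
  push_cast
  rw [show b + ((n : ℂ) + 1) = b + 1 + n by ring]
  by_cases hG : Complex.Gamma (b + 1 + n) = 0
  · simp [hG]
  · field_simp

theorem deriv_kummerReg (a b : ℂ) :
    deriv (kummerReg a b) = fun z => a * kummerReg (a + 1) (b + 1) z := by
  ext z
  refine (hasSum_deriv_kummerReg a b z).unique ?_
  refine ((hasSum_kummerReg (a + 1) (b + 1) z).mul_left a).congr_fun fun n => ?_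
  rw [succ_mul_regularizedHGFunCoeff, mul_assoc]

theorem differentiable_deriv_kummerReg (a b : ℂ) : Differentiable ℂ (deriv (kummerReg a b)) := by
  rw [deriv_kummerReg]
  exact (differentiable_kummerReg _ _).const_mul a

/-- Kummer's differential equation, by comparison of coefficients. -/
theorem kummerReg_ode (a b z : ℂ) (hb : ∀ k : ℕ, b ≠ -k) :
    z * deriv (deriv (kummerReg a b)) z + (b - z) * deriv (kummerReg a b) z
      = a * kummerReg a b z := by
  have h0 := hasSum_kummerReg a b z
  have h1 := hasSum_deriv_kummerReg a b z
  have h1' := h1.mul_pow_shift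
  have h2 : HasSum (fun n : ℕ => (n : ℂ) *
      (((n : ℂ) + 1) * Complex.regularizedHGFunCoeff {a} {b} (n + 1)) * z ^ n)
      (z * deriv (deriv (kummerReg a b)) z) := by
    apply HasSum.mul_pow_shift
      (c := fun n => ((n : ℂ) + 1) * Complex.regularizedHGFunCoeff {a} {b} (n + 1))
    have h3 := (hasSum_deriv_kummerReg (a + 1) (b + 1) z).mul_left a
    rw [show deriv (deriv (kummerReg a b)) z = a * deriv (kummerReg (a + 1) (b + 1)) z by
      rw [deriv_kummerReg]
      exact deriv_const_mul a (differentiable_kummerReg _ _ z)]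
    refine h3.congr_fun fun n => ?_
    have := succ_mul_regularizedHGFunCoeff a b (n + 1)
    push_cast at this ⊢
    rw [this]
    ring
  have hR := (h0.mul_left a).add h1'
  have hL := (h2.add (h1.mul_left b)).unique (hR.congr_fun fun n => ?_)
  · linear_combination hL
  · have h3 : b + n ≠ 0 := fun h => hb n (by linear_combination h)
    have h4 : ((n : ℂ) + 1) ≠ 0 := by exact_mod_cast n.succ_ne_zero
    rw [Complex.regularizedHGFunCoeff_add_one (by simpa using hb n)]
    simp only [Multiset.map_singleton, Multiset.prod_singleton]
    field_simp
    ring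

/-- The entire function `e^{-z/2} M(1 - i, 2, z) = M_{i,1/2}(z) / z`. -/
noncomputable def whittakerQuot (z : ℂ) : ℂ :=
  Complex.exp (-z / 2) * kummerReg (1 - Complex.I) 2 z

/-- The derivative of `M_{i,1/2}`. -/
noncomputable def whittakerDeriv (z : ℂ) : ℂ :=
  Complex.exp (-z / 2) * (kummerReg (1 - Complex.I) 2 z
    + z * deriv (kummerReg (1 - Complex.I) 2) z - z / 2 * kummerReg (1 - Complex.I) 2 z)

theorem whittakerM_I_half (z : ℂ) :
    whittakerM Complex.I (1 / 2) z = z * whittakerQuot z := by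
  have h1 : (1 / 2 + 1 / 2 - Complex.I : ℂ) = 1 - Complex.I := by ring
  have h2 : (1 + 2 * (1 / 2) : ℂ) = 2 := by norm_num
  have h3 : (1 / 2 + 1 / 2 : ℂ) = 1 := by norm_num
  have h4 : Complex.Gamma 2 = 1 := by simp
  rw [whittakerM, kummerM, h1, h2, h3, h4, Complex.cpow_one, whittakerQuot, kummerReg]
  ring

theorem hasDerivAt_mul_whittakerQuot (z : ℂ) :
    HasDerivAt (fun z => z * whittakerQuot z) (whittakerDeriv z) z := by
  have hF := (differentiable_kummerReg (1 - Complex.I) 2 z).hasDerivAt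
  have hE : HasDerivAt (fun z : ℂ => Complex.exp (-z / 2)) (Complex.exp (-z / 2) * (-1 / 2)) z :=
    ((hasDerivAt_id z).neg.div_const 2).cexp
  refine ((hasDerivAt_id z).mul (hE.mul hF)).congr_deriv ?_
  simp only [whittakerDeriv, id, Pi.mul_apply]
  ring

/-- Whittaker's differential equation `z W'' = (z / 4 - i) W`. -/
theorem hasDerivAt_whittakerDeriv (z : ℂ) :
    HasDerivAt whittakerDeriv ((z / 4 - Complex.I) * whittakerQuot z) z := by
  have hF := (differentiable_kummerReg (1 - Complex.I) 2 z).hasDerivAt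
  have hF' := (differentiable_deriv_kummerReg (1 - Complex.I) 2 z).hasDerivAt
  have hE : HasDerivAt (fun z : ℂ => Complex.exp (-z / 2)) (Complex.exp (-z / 2) * (-1 / 2)) z :=
    ((hasDerivAt_id z).neg.div_const 2).cexp
  have hode := kummerReg_ode (1 - Complex.I) 2 z (fun k h => by
    have := congrArg Complex.re h
    simp only [Complex.re_ofNat, Complex.neg_re, Complex.natCast_re] at this
    have : (0 : ℝ) ≤ k := k.cast_nonneg
    linarith)
  refine (hE.mul ((hF.add ((hasDerivAt_id z).mul hF')).sub
    (((hasDerivAt_id z).div_const 2).mul hF))).congr_deriv ?_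
  simp only [whittakerQuot, id, Pi.mul_apply, Pi.add_apply, Pi.sub_apply]
  linear_combination Complex.exp (-z / 2) * hode

theorem deriv_whittakerM_I_half (z : ℂ) :
    deriv (whittakerM Complex.I (1 / 2)) z = whittakerDeriv z := by
  rw [funext whittakerM_I_half]
  exact (hasDerivAt_mul_whittakerQuot z).deriv

/-- `v(r) = r g(r)` solves `v'' = (1 / r - 1 / 4) v`, with `v' = w`; writing the equation in terms
of the quotient `g` makes it regular at `r = 0`. -/
structure IsCoulombPair (g w : ℝ → ℝ) : Prop where
  hasDerivAt_mul : ∀ r, HasDerivAt (fun r => r * g r) (w r) r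
  hasDerivAt_snd : ∀ r, HasDerivAt w ((1 - r / 4) * g r) r

theorem hasDerivAt_whittaker_real (r : ℝ) :
    HasDerivAt (fun r : ℝ => (r : ℂ) * whittakerQuot (Complex.I * r))
        (whittakerDeriv (Complex.I * r)) r ∧
      HasDerivAt (fun r : ℝ => whittakerDeriv (Complex.I * r))
        (((1 - r / 4 : ℝ) : ℂ) * whittakerQuot (Complex.I * r)) r := by
  have hI : HasDerivAt (fun z : ℂ => Complex.I * z) Complex.I r := by
    simpa using (hasDerivAt_id (r : ℂ)).const_mul Complex.I
  constructor
  · have := (((hasDerivAt_mul_whittakerQuot (Complex.I * r)).comp (r : ℂ) hI).const_mul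
      (-Complex.I)).comp_ofReal
    refine (this.congr_deriv ?_).congr_of_eventuallyEq (Eventually.of_forall fun s => ?_)
    · linear_combination -whittakerDeriv (Complex.I * r) * Complex.I_sq
    · simp only [Function.comp]
      linear_combination s * whittakerQuot (Complex.I * s) * Complex.I_sq
  · have := ((hasDerivAt_whittakerDeriv (Complex.I * r)).comp (r : ℂ) hI).comp_ofReal
    refine this.congr_deriv ?_
    push_cast
    linear_combination (r / 4 - 1) * whittakerQuot (Complex.I * r) * Complex.I_sq

theorem isCoulombPair_re : IsCoulombPair (fun r => (whittakerQuot (Complex.I * r)).re)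
    (fun r => (whittakerDeriv (Complex.I * r)).re) where
  hasDerivAt_mul r := by
    exact (Complex.reCLM.hasFDerivAt.comp_hasDerivAt r
      (hasDerivAt_whittaker_real r).1).congr_of_eventuallyEq
        (Eventually.of_forall fun s => (Complex.re_ofReal_mul _ _).symm)
  hasDerivAt_snd r := by
    refine (Complex.reCLM.hasFDerivAt.comp_hasDerivAt r (hasDerivAt_whittaker_real r).2).congr_deriv ?_
    rw [Complex.reCLM_apply, Complex.re_ofReal_mul]

theorem isCoulombPair_im : IsCoulombPair (fun r => (whittakerQuot (Complex.I * r)).im)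
    (fun r => (whittakerDeriv (Complex.I * r)).im) where
  hasDerivAt_mul r := by
    exact (Complex.imCLM.hasFDerivAt.comp_hasDerivAt r
      (hasDerivAt_whittaker_real r).1).congr_of_eventuallyEq
        (Eventually.of_forall fun s => (Complex.im_ofReal_mul _ _).symm)
  hasDerivAt_snd r := by
    refine (Complex.imCLM.hasFDerivAt.comp_hasDerivAt r (hasDerivAt_whittaker_real r).2).congr_deriv ?_
    rw [Complex.imCLM_apply, Complex.im_ofReal_mul]

theorem kummerReg_zero (a : ℂ) : kummerReg a 2 0 = 1 := by
  have h := hasSum_kummerReg a 2 0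
  refine h.unique ?_
  convert hasSum_single (f := fun n : ℕ => Complex.regularizedHGFunCoeff {a} {2} n * 0 ^ n) 0
    fun n hn => by simp [hn] using 1
  simp [Complex.regularizedHGFunCoeff]

theorem whittakerDeriv_zero : whittakerDeriv 0 = 1 := by
  simp [whittakerDeriv, kummerReg_zero]

/-- The Wronskian of two solutions that are regular at `0` vanishes. -/
theorem IsCoulombPair.wronskian_eq_zero {g w g' w' : ℝ → ℝ} (h : IsCoulombPair g w)
    (h' : IsCoulombPair g' w') (r : ℝ) : r * g r * w' r = r * g' r * w r := by
  have hd : ∀ s, HasDerivAt (fun r => r * g r * w' r - r * g' r * w r) 0 s := fun s =>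
    (((h.hasDerivAt_mul s).mul (h'.hasDerivAt_snd s)).sub
      ((h'.hasDerivAt_mul s).mul (h.hasDerivAt_snd s))).congr_deriv (by ring)
  have := is_const_of_deriv_eq_zero (fun s => (hd s).differentiableAt) (fun s => (hd s).deriv) r 0
  simp only [zero_mul, sub_zero] at this
  linarith

/-! ### The phase equation -/

/-- The right-hand side of the phase equation `φ' = 2 - 2 cos φ - h(t)`. -/
noncomputable def phaseField (h : ℝ → ℝ) (t x : ℝ) : ℝ := 2 - 2 * Real.cos x - h t

/-- A global solution of the phase equation `φ' = 2 - 2 cos φ - h(t)`. -/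
def IsPhase (h φ : ℝ → ℝ) : Prop := ∀ t, HasDerivAt φ (phaseField h t (φ t)) t

theorem lipschitzWith_phaseField (h : ℝ → ℝ) (t : ℝ) : LipschitzWith 2 (phaseField h t) := by
  refine LipschitzWith.of_dist_le_mul fun x y => ?_
  rw [Real.dist_eq, Real.dist_eq, phaseField, phaseField,
    show 2 - 2 * Real.cos x - h t - (2 - 2 * Real.cos y - h t)
      = 2 * (Real.cos y - Real.cos x) by ring, abs_mul, abs_two, abs_sub_comm x y]
  have := Real.lipschitzWith_cos.dist_le_mul y x
  simp only [Real.dist_eq, NNReal.coe_one, one_mul] at this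
  push_cast
  linarith

theorem IsPhase.unique {h φ χ : ℝ → ℝ} (hφ : IsPhase h φ) (hχ : IsPhase h χ) {t : ℝ}
    (ht : φ t = χ t) : φ = χ :=
  ODE_solution_unique_univ (v := phaseField h) (s := fun _ => Set.univ) (K := 2)
    (fun t => (lipschitzWith_phaseField h t).lipschitzOnWith)
    (fun t => ⟨hφ t, trivial⟩) (fun t => ⟨hχ t, trivial⟩) ht

/-- The phase field is bounded on compact time intervals, so the Picard-Lindelöf theorem applies
on every interval `[t₀ - T, t₀ + T]`. -/
theorem exists_phase_on_Icc {h : ℝ → ℝ} (hh : Continuous h) (t₀ x₀ T : ℝ) (hT : 0 ≤ T) :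
    ∃ φ : ℝ → ℝ, φ t₀ = x₀ ∧ ∀ t ∈ Set.Ioo (t₀ - T) (t₀ + T),
      HasDerivAt φ (phaseField h t (φ t)) t := by
  obtain ⟨B, hB⟩ := (isCompact_Icc (a := t₀ - T) (b := t₀ + T)).exists_bound_of_continuousOn
    hh.continuousOn
  have hB0 : 0 ≤ B := (norm_nonneg _).trans (hB t₀ ⟨by linarith, by linarith⟩)
  lift T to NNReal using hT
  obtain ⟨L, hL⟩ : ∃ L : NNReal, (L : ℝ) = 4 + B := ⟨⟨4 + B, by linarith⟩, rfl⟩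
  have hP : IsPicardLindelof (phaseField h) (tmin := t₀ - T) (tmax := t₀ + T)
      ⟨t₀, by constructor <;> linarith [T.coe_nonneg]⟩ x₀ (L * T) 0 L 2 := by
    refine ⟨fun t _ => (lipschitzWith_phaseField h t).lipschitzOnWith, fun x _ => ?_,
      fun t ht x _ => ?_, ?_⟩
    · exact (continuous_const.sub hh).continuousOn
    · have h1 := Real.neg_one_le_cos x
      have h2 := Real.cos_le_one x
      have h3 := abs_le.1 (hB t ht)
      rw [hL, Real.norm_eq_abs, phaseField, abs_le]
      constructor <;> linarith [h3.1, h3.2]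
    · simp
  obtain ⟨φ, h0, hφ⟩ := hP.exists_eq_forall_mem_Icc_hasDerivWithinAt₀
  exact ⟨φ, h0, fun t ht => (hφ t ⟨ht.1.le, ht.2.le⟩).hasDerivAt (Icc_mem_nhds ht.1 ht.2)⟩

theorem exists_isPhase {h : ℝ → ℝ} (hh : Continuous h) (t₀ x₀ : ℝ) :
    ∃ φ, IsPhase h φ ∧ φ t₀ = x₀ := by
  choose f hf0 hf using fun n : ℕ => exists_phase_on_Icc hh t₀ x₀ n n.cast_nonneg
  have hagree : ∀ m n : ℕ, m ≤ n → ∀ t, |t - t₀| < m → f m t = f n t := by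
    intro m n hmn t ht
    have hm : (0 : ℝ) < m := (abs_nonneg _).trans_lt ht
    have hmn' : (m : ℝ) ≤ n := by exact_mod_cast hmn
    rw [abs_lt] at ht
    exact ODE_solution_unique_of_mem_Ioo (v := phaseField h) (s := fun _ => Set.univ) (K := 2)
      (fun t _ => (lipschitzWith_phaseField h t).lipschitzOnWith)
      (t₀ := t₀) (a := t₀ - m) (b := t₀ + m) ⟨by linarith, by linarith⟩
      (fun s hs => ⟨hf m s hs, trivial⟩)
      (fun s hs => ⟨hf n s ⟨by linarith [hs.1], by linarith [hs.2]⟩, trivial⟩)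
      ((hf0 m).trans (hf0 n).symm) ⟨by linarith [ht.1], by linarith [ht.2]⟩
  refine ⟨fun t => f (⌊|t - t₀|⌋₊ + 1) t, fun t => ?_, hf0 _⟩
  obtain ⟨N, hN⟩ := exists_nat_gt |t - t₀|
  have hev : (fun t => f (⌊|t - t₀|⌋₊ + 1) t) =ᶠ[𝓝 t] f N := by
    have : ∀ᶠ s in 𝓝 t, |s - t₀| < N :=
      (continuous_abs.comp (continuous_id.sub continuous_const)).continuousAt.eventually_lt
        continuousAt_const hN
    filter_upwards [this] with s hs
    refine hagree _ _ ?_ s (by push_cast; exact Nat.lt_floor_add_one _)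
    exact Nat.succ_le_of_lt ((Nat.floor_lt (abs_nonneg _)).2 hs)
  rw [abs_lt] at hN
  beta_reduce
  rw [show f (⌊|t - t₀|⌋₊ + 1) t = f N t from hev.self_of_nhds]
  exact (hf N t ⟨by linarith [hN.1], by linarith [hN.2]⟩).congr_of_eventuallyEq hev

theorem phase_eq_of_eq_left {h φ χ : ℝ → ℝ} {s : ℝ}
    (hφ : ∀ t ≥ s, HasDerivAt φ (phaseField h t (φ t)) t)
    (hχ : ∀ t ≥ s, HasDerivAt χ (phaseField h t (χ t)) t) (h0 : φ s = χ s) {t : ℝ} (ht : s ≤ t) :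
    φ t = χ t :=
  ODE_solution_unique (v := phaseField h) (lipschitzWith_phaseField h)
    (fun r hr => (hφ r hr.1).continuousAt.continuousWithinAt)
    (fun r hr => (hφ r hr.1).hasDerivWithinAt)
    (fun r hr => (hχ r hr.1).continuousAt.continuousWithinAt)
    (fun r hr => (hχ r hr.1).hasDerivWithinAt) h0 (Set.right_mem_Icc.2 ht)

/-- Solutions of the phase equation do not cross. -/
theorem phase_lt_of_lt_left {h φ χ : ℝ → ℝ} {s : ℝ}
    (hφ : ∀ t ≥ s, HasDerivAt φ (phaseField h t (φ t)) t)
    (hχ : ∀ t ≥ s, HasDerivAt χ (phaseField h t (χ t)) t) (h0 : φ s < χ s) {t : ℝ} (ht : s ≤ t) :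
    φ t < χ t := by
  by_contra! hlt
  have hcφ : ContinuousOn φ (Set.Icc s t) := fun r hr =>
    (hφ r hr.1).continuousAt.continuousWithinAt
  have hcχ : ContinuousOn χ (Set.Icc s t) := fun r hr =>
    (hχ r hr.1).continuousAt.continuousWithinAt
  obtain ⟨r, hr, hr0⟩ := intermediate_value_Icc ht (hcφ.sub hcχ)
    (show (0 : ℝ) ∈ Set.Icc ((φ - χ) s) ((φ - χ) t) from
      ⟨by simpa using h0.le, by simpa using hlt⟩)
  have hrr : φ r = χ r := by simpa [sub_eq_zero] using hr0
  have := ODE_solution_unique_of_mem_Icc_left (v := phaseField h) (s := fun _ => Set.univ) (K := 2)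
    (a := s) (b := r) (fun t _ => (lipschitzWith_phaseField h t).lipschitzOnWith)
    (hcφ.mono (Set.Icc_subset_Icc_right hr.2)) (fun q hq => (hφ q hq.1.le).hasDerivWithinAt)
    (fun _ _ => trivial)
    (hcχ.mono (Set.Icc_subset_Icc_right hr.2)) (fun q hq => (hχ q hq.1.le).hasDerivWithinAt)
    (fun _ _ => trivial) hrr (Set.left_mem_Icc.2 hr.1)
  exact h0.ne this

/-- If a function and its derivative both converge at `+∞`, the derivative tends to `0`. -/
theorem eq_zero_of_tendsto_hasDerivAt {f f' : ℝ → ℝ} {s L c : ℝ}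
    (hf : ∀ t ≥ s, HasDerivAt f (f' t) t) (hL : Tendsto f atTop (𝓝 L))
    (hc : Tendsto f' atTop (𝓝 c)) : c = 0 := by
  have hmv : ∀ t, ∃ ξ, t ≤ ξ ∧ (s ≤ t → f' ξ = f (t + 1) - f t) := by
    intro t
    by_cases hst : s ≤ t
    · obtain ⟨ξ, hξ, he⟩ := exists_hasDerivAt_eq_slope f f' (show t < t + 1 by linarith)
        (fun r hr => (hf r (hst.trans hr.1)).continuousAt.continuousWithinAt)
        (fun r hr => hf r (hst.trans hr.1.le))
      exact ⟨ξ, hξ.1.le, fun _ => by rw [he]; simp⟩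
    · exact ⟨t, le_rfl, fun h => absurd h hst⟩
  choose ξ hξ he using hmv
  have h1 : Tendsto (fun t => f' (ξ t)) atTop (𝓝 c) :=
    hc.comp (tendsto_atTop_mono hξ tendsto_id)
  have h2 : Tendsto (fun t => f (t + 1) - f t) atTop (𝓝 (L - L)) :=
    (hL.comp (tendsto_atTop_add_const_right _ _ tendsto_id)).sub hL
  rw [sub_self] at h2
  refine tendsto_nhds_unique (h1.congr' ?_) h2
  filter_upwards [eventually_ge_atTop s] with t ht using he t ht

/-- Since `φ - e^{-t}` is nondecreasing along `φ' = 2 - 2 cos φ - e^{-t}`, a solution bounded above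
converges to a zero of `1 - cos`. -/
theorem exists_tendsto_of_phase_exp {φ : ℝ → ℝ} {s C : ℝ}
    (hφ : ∀ t ≥ s, HasDerivAt φ (phaseField (fun t => Real.exp (-t)) t (φ t)) t)
    (hC : ∀ t ≥ s, φ t ≤ C) : ∃ L, Tendsto φ atTop (𝓝 L) ∧ Real.cos L = 1 := by
  have hexp : Tendsto (fun t : ℝ => Real.exp (-t)) atTop (𝓝 0) :=
    Real.tendsto_exp_neg_atTop_nhds_zero
  have hd : ∀ t ≥ s, HasDerivAt (fun t => φ t - Real.exp (-t)) (2 - 2 * Real.cos (φ t)) t :=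
    fun t ht => ((hφ t ht).sub (hasDerivAt_neg t).exp).congr_deriv (by rw [phaseField]; ring)
  have hmono : MonotoneOn (fun t => φ t - Real.exp (-t)) (Set.Ici s) := by
    refine monotoneOn_of_hasDerivWithinAt_nonneg (convex_Ici s)
      (fun t ht => (hd t ht).continuousAt.continuousWithinAt)
      (fun t ht => (hd t (interior_subset ht)).hasDerivWithinAt) fun t _ => ?_
    linarith [Real.cos_le_one (φ t)]
  have hm : Monotone fun t => φ (max t s) - Real.exp (-(max t s)) := fun t t' h =>
    hmono (Set.mem_Ici.2 (le_max_right _ _)) (Set.mem_Ici.2 (le_max_right _ _)) (max_le_max_right s h)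
  have hev : (fun t => φ (max t s) - Real.exp (-(max t s))) =ᶠ[atTop]
      fun t => φ t - Real.exp (-t) := by
    filter_upwards [eventually_ge_atTop s] with t ht
    rw [max_eq_left ht]
  obtain ⟨L, hL⟩ : ∃ L, Tendsto (fun t => φ t - Real.exp (-t)) atTop (𝓝 L) := by
    rcases tendsto_atTop_of_monotone hm with h | ⟨L, h⟩
    · obtain ⟨t, ht⟩ := (h.eventually_gt_atTop C).exists
      have := hC (max t s) (le_max_right _ _)
      linarith [Real.exp_pos (-(max t s))]
    · exact ⟨L, h.congr' hev⟩
  have hφL : Tendsto φ atTop (𝓝 L) := by simpa using hL.add hexp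
  refine ⟨L, hφL, ?_⟩
  have := eq_zero_of_tendsto_hasDerivAt hd hL
    (((Real.continuous_cos.tendsto L).comp hφL).const_mul 2 |>.const_sub 2)
  linarith

/-- The positive solution `χ` that decays to `0` is a separatrix: all solutions that start between
`χ - 2π` (excluded) and `χ` converge to `0`. Two distinct solutions cannot approach an equilibrium
from above, since their distance increases near it. -/
theorem tendsto_zero_of_phase_between {φ χ : ℝ → ℝ} {s : ℝ}
    (hφ : ∀ t ≥ s, HasDerivAt φ (phaseField (fun t => Real.exp (-t)) t (φ t)) t)
    (hχ : ∀ t ≥ s, HasDerivAt χ (phaseField (fun t => Real.exp (-t)) t (χ t)) t)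
    (hpos : ∀ t ≥ s, 0 < χ t) (hχ0 : Tendsto χ atTop (𝓝 0))
    (h1 : χ s - 2 * Real.pi < φ s) (h2 : φ s ≤ χ s) : Tendsto φ atTop (𝓝 0) := by
  rcases h2.eq_or_lt with h2 | h2
  · refine hχ0.congr' ?_
    filter_upwards [eventually_ge_atTop s] with t ht using (phase_eq_of_eq_left hφ hχ h2 ht).symm
  have hχs : ∀ t ≥ s, HasDerivAt (fun t => χ t - 2 * Real.pi)
      (phaseField (fun t => Real.exp (-t)) t (χ t - 2 * Real.pi)) t := fun t ht => by
    refine ((hχ t ht).sub_const _).congr_deriv ?_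
    rw [phaseField, phaseField, Real.cos_sub_two_pi]
  have hup : ∀ t ≥ s, φ t < χ t := fun t ht => phase_lt_of_lt_left hφ hχ h2 ht
  have hlow : ∀ t ≥ s, χ t - 2 * Real.pi < φ t := fun t ht => phase_lt_of_lt_left hχs hφ h1 ht
  obtain ⟨L, hL, hcos⟩ : ∃ L, Tendsto φ atTop (𝓝 L) ∧ Real.cos L = 1 := by
    obtain ⟨T, hT⟩ := eventually_atTop.1 (hχ0.eventually_lt_const zero_lt_one)
    exact exists_tendsto_of_phase_exp (s := max s T) (C := 1)
      (fun t ht => hφ t ((le_max_left _ _).trans ht))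
      fun t ht => ((hup t ((le_max_left _ _).trans ht)).trans
        (hT t ((le_max_right _ _).trans ht))).le
  have hL0 : L ≤ 0 := le_of_tendsto_of_tendsto hL hχ0
    ((eventually_ge_atTop s).mono fun t ht => (hup t ht).le)
  have hL1 : 0 - 2 * Real.pi ≤ L := le_of_tendsto_of_tendsto (hχ0.sub_const _) hL
    ((eventually_ge_atTop s).mono fun t ht => (hlow t ht).le)
  have hpi := Real.pi_pos
  rcases hL1.eq_or_lt with hL2 | hL2
  · exfalso
    rw [zero_sub] at hL2
    have hε : Tendsto (fun t => φ t + 2 * Real.pi) atTop (𝓝 0) := by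
      simpa [← hL2] using hL.add_const (2 * Real.pi)
    obtain ⟨T, hT⟩ := eventually_atTop.1 (hε.eventually_lt_const hpi)
    set S := max s T
    have hsS : ∀ t ≥ S, s ≤ t := fun t ht => (le_max_left _ _).trans ht
    have hmono : MonotoneOn (fun t => φ t + 2 * Real.pi - χ t) (Set.Ici S) := by
      have hd : ∀ t ≥ S, HasDerivAt (fun t => φ t + 2 * Real.pi - χ t)
          (2 * Real.cos (χ t) - 2 * Real.cos (φ t + 2 * Real.pi)) t := fun t ht =>
        (((hφ t (hsS t ht)).add_const _).sub (hχ t (hsS t ht))).congr_deriv (by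
          rw [phaseField, phaseField, Real.cos_add_two_pi]; ring)
      refine monotoneOn_of_hasDerivWithinAt_nonneg (convex_Ici S)
        (fun t ht => (hd t ht).continuousAt.continuousWithinAt)
        (fun t ht => (hd t (interior_subset ht)).hasDerivWithinAt) fun t ht => ?_
      have ht' : S ≤ t := interior_subset ht
      have := Real.cos_le_cos_of_nonneg_of_le_pi (hpos t (hsS t ht')).le
        (hT t ((le_max_right _ _).trans ht')).le
        (show χ t ≤ φ t + 2 * Real.pi by linarith [hlow t (hsS t ht')])
      linarith
    have hlim : Tendsto (fun t => φ t + 2 * Real.pi - χ t) atTop (𝓝 0) := by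
      simpa using hε.sub hχ0
    have hge : φ S + 2 * Real.pi - χ S ≤ 0 := ge_of_tendsto hlim
      ((eventually_ge_atTop S).mono fun t ht => hmono Set.self_mem_Ici ht ht)
    linarith [hlow S (le_max_left _ _)]
  · have : L = 0 := (Real.cos_eq_one_iff_of_lt_of_lt (by linarith) (by linarith)).1 hcos
    rwa [this] at hL

/-! ### The separatrix -/

namespace IsCoulombPair

variable {g w : ℝ → ℝ}

/-- Up to `r = 4` the coefficient `1 / r - 1 / 4` is nonnegative, so `v v'` increases from `0`. -/
theorem mul_pos_of_le_four (h : IsCoulombPair g w) (hw : w 0 = 1) {r : ℝ} (h0 : 0 < r)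
    (h4 : r ≤ 4) : 0 < r * g r * w r := by
  have hd : ∀ s, HasDerivAt (fun r => r * g r * w r) (w s ^ 2 + s * (1 - s / 4) * g s ^ 2) s :=
    fun s => ((h.hasDerivAt_mul s).mul (h.hasDerivAt_snd s)).congr_deriv (by ring)
  have hnn : ∀ s ∈ Set.Icc (0 : ℝ) 4, 0 ≤ s * (1 - s / 4) * g s ^ 2 := fun s hs =>
    mul_nonneg (mul_nonneg hs.1 (by linarith [hs.2])) (sq_nonneg _)
  have hmono : MonotoneOn (fun r => r * g r * w r) (Set.Icc 0 4) :=
    monotoneOn_of_hasDerivWithinAt_nonneg (convex_Icc 0 4)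
      (fun s _ => (hd s).continuousAt.continuousWithinAt)
      (fun s _ => (hd s).hasDerivWithinAt)
      fun s hs => add_nonneg (sq_nonneg _) (hnn s (interior_subset hs))
  have hge : ∀ s ∈ Set.Icc (0 : ℝ) 4, 0 ≤ s * g s * w s := fun s hs => by
    simpa using hmono (Set.left_mem_Icc.2 (by norm_num)) hs hs.1
  refine (hge r ⟨h0.le, h4⟩).lt_of_ne' fun hz => ?_
  -- If `v v'` vanished at `r`, it would vanish on `[0, r]`, and so would `v'`.
  have hzero : ∀ s ∈ Set.Ioo 0 r, w s = 0 := by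
    intro s hs
    have hev : (fun r => r * g r * w r) =ᶠ[𝓝 s] fun _ => 0 := by
      filter_upwards [Ioo_mem_nhds hs.1 hs.2] with q hq
      have hq4 : q ∈ Set.Icc (0 : ℝ) 4 := ⟨hq.1.le, hq.2.le.trans h4⟩
      exact le_antisymm ((hmono hq4 ⟨h0.le, h4⟩ hq.2.le).trans hz.le) (hge q hq4)
    have h1 := (hd s).unique ((hasDerivAt_const s (0 : ℝ)).congr_of_eventuallyEq hev)
    have h2 := hnn s ⟨hs.1.le, hs.2.le.trans h4⟩
    exact pow_eq_zero_iff two_ne_zero |>.1 (le_antisymm (by linarith) (sq_nonneg _))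
  have hlim : Tendsto w (𝓝[>] 0) (𝓝 (w 0)) :=
    (h.hasDerivAt_snd 0).continuousAt.tendsto.mono_left nhdsWithin_le_nhds
  have hlim0 : Tendsto w (𝓝[>] 0) (𝓝 0) := by
    refine tendsto_const_nhds.congr' ?_
    filter_upwards [Ioo_mem_nhdsGT h0] with s hs using (hzero s hs).symm
  have := tendsto_nhds_unique hlim hlim0
  rw [hw] at this
  exact one_ne_zero this

end IsCoulombPair

/-- A scalar linear homogeneous equation with bounded coefficient: a solution with a zero is `0`. -/
theorem eq_zero_of_hasDerivAt_sin_mul {f A : ℝ → ℝ} {c : ℝ} (hc : |c| ≤ 1)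
    (hf : ∀ t, HasDerivAt f (c * Real.sin (A t) * f t) t) {t₀ : ℝ} (h0 : f t₀ = 0) (t : ℝ) :
    f t = 0 := by
  have hL : ∀ t, LipschitzWith 1 fun x => c * Real.sin (A t) * x := fun t => by
    refine LipschitzWith.of_dist_le_mul fun x y => ?_
    rw [Real.dist_eq, Real.dist_eq, ← mul_sub, abs_mul, abs_mul]
    push_cast
    gcongr
    exact mul_le_one₀ hc (abs_nonneg _) (Real.abs_sin_le_one _)
  exact congrFun (ODE_solution_unique_univ (v := fun t x => c * Real.sin (A t) * x)
    (s := fun _ => Set.univ) (K := 1) (g := fun _ => 0) (fun t => (hL t).lipschitzOnWith)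
    (fun t => ⟨hf t, trivial⟩)
    (fun t => ⟨by simpa using hasDerivAt_const t (0 : ℝ), trivial⟩) h0) t

/-- `A` is the angle of the separatrix: twice the Prüfer angle of `(v, 2 v')`, where `v(r)` is the
solution of `v'' = (1 / r - 1 / 4) v` regular at `0` and `r = e^{-t}`. -/
structure IsSeparatrix (g w A : ℝ → ℝ) : Prop where
  isPhase : IsPhase (fun t => Real.exp (-t)) A
  exists_radius : ∀ t, ∃ P : ℝ, P ≠ 0 ∧
    Real.exp (-t) * g (Real.exp (-t)) = P * Real.sin (A t / 2) ∧
    2 * w (Real.exp (-t)) = P * Real.cos (A t / 2)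
  mem_Ioo_log_four : A (-Real.log 4) ∈ Set.Ioo 0 Real.pi

theorem IsCoulombPair.exists_isSeparatrix {g w : ℝ → ℝ} (h : IsCoulombPair g w) (hw : w 0 = 1) :
    ∃ A, IsSeparatrix g w A := by
  have hpos := h.mul_pos_of_le_four hw (r := 4) (by norm_num) le_rfl
  set q := 4 * g 4 / (2 * w 4) with hq
  have hw4 : w 4 ≠ 0 := fun h0 => by simp [h0] at hpos
  have hqpos : 0 < q := by
    have : q = 4 * g 4 * w 4 / (2 * w 4 ^ 2) := by rw [hq]; field_simp
    rw [this]
    positivity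
  obtain ⟨A, hA, hA0⟩ := exists_isPhase (h := fun t => Real.exp (-t))
    (by fun_prop) (-Real.log 4) (2 * Real.arctan q)
  have h4 : Real.exp (-(-Real.log 4)) = 4 := by rw [neg_neg, Real.exp_log (by norm_num)]
  set x : ℝ → ℝ := fun t => Real.exp (-t) * g (Real.exp (-t)) with hx
  set y : ℝ → ℝ := fun t => 2 * w (Real.exp (-t)) with hy
  have he : ∀ t, HasDerivAt (fun t : ℝ => Real.exp (-t)) (-Real.exp (-t)) t := fun t =>
    (hasDerivAt_neg t).exp.congr_deriv (by ring)
  have hdx : ∀ t, HasDerivAt x (-(Real.exp (-t) / 2) * y t) t := fun t => by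
    have := (h.hasDerivAt_mul (Real.exp (-t))).comp t (he t)
    exact this.congr_deriv (by simp only [hy]; ring)
  have hdy : ∀ t, HasDerivAt y ((Real.exp (-t) / 2 - 2) * x t) t := fun t =>
    (((h.hasDerivAt_snd (Real.exp (-t))).comp t (he t)).const_mul 2).congr_deriv
      (by simp only [hx]; ring)
  have hψ : ∀ t, HasDerivAt (fun t => A t / 2)
      (2 * Real.sin (A t / 2) ^ 2 - Real.exp (-t) / 2) t := fun t => by
    refine ((hA t).div_const 2).congr_deriv ?_
    have : Real.cos (A t) = 1 - 2 * Real.sin (A t / 2) ^ 2 := by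
      have := Real.cos_two_mul' (A t / 2)
      rw [mul_div_cancel₀ _ (two_ne_zero' ℝ)] at this
      linarith [Real.sin_sq_add_cos_sq (A t / 2)]
    rw [phaseField, this]
    ring
  have hsin : ∀ t, Real.sin (A t) = 2 * Real.sin (A t / 2) * Real.cos (A t / 2) := fun t => by
    rw [← Real.sin_two_mul, mul_div_cancel₀ _ (two_ne_zero' ℝ)]
  -- `Q` and `P` are the components of `(x, y)` across and along the direction of angle `A / 2`.
  set Q : ℝ → ℝ := fun t => x t * Real.cos (A t / 2) - y t * Real.sin (A t / 2) with hQ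
  set P : ℝ → ℝ := fun t => x t * Real.sin (A t / 2) + y t * Real.cos (A t / 2) with hP
  have hdQ : ∀ t, HasDerivAt Q (1 * Real.sin (A t) * Q t) t := fun t => by
    refine (((hdx t).mul (hψ t).cos).sub ((hdy t).mul (hψ t).sin)).congr_deriv ?_
    rw [hsin]
    simp only [hQ]
    linear_combination (-2 * x t * Real.sin (A t / 2)) * Real.sin_sq_add_cos_sq (A t / 2)
  have hQ0 : ∀ t, Q t = 0 := by
    refine eq_zero_of_hasDerivAt_sin_mul (by simp) hdQ (t₀ := -Real.log 4) ?_
    simp only [hQ, hA0, hx, hy, h4]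
    rw [mul_div_cancel_left₀ _ (two_ne_zero' ℝ)]
    have hcos := (Real.cos_arctan_pos q).ne'
    have ht := Real.tan_arctan q
    rw [Real.tan_eq_sin_div_cos, div_eq_iff hcos] at ht
    rw [ht, hq]
    field_simp
    ring
  have hxP : ∀ t, x t = P t * Real.sin (A t / 2) := fun t => by
    have := hQ0 t
    simp only [hQ, hP] at this ⊢
    linear_combination Real.cos (A t / 2) * this - x t * Real.sin_sq_add_cos_sq (A t / 2)
  have hyP : ∀ t, y t = P t * Real.cos (A t / 2) := fun t => by
    have := hQ0 t
    simp only [hQ, hP] at this ⊢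
    linear_combination -Real.sin (A t / 2) * this - y t * Real.sin_sq_add_cos_sq (A t / 2)
  have hdP : ∀ t, HasDerivAt P (-1 * Real.sin (A t) * P t) t := fun t => by
    refine (((hdx t).mul (hψ t).sin).add ((hdy t).mul (hψ t).cos)).congr_deriv ?_
    rw [hsin, hxP t, hyP t]
    ring
  refine ⟨A, hA, fun t => ⟨P t, fun h0 => ?_, hxP t, hyP t⟩, ?_⟩
  · have hP4 := eq_zero_of_hasDerivAt_sin_mul (by simp) hdP h0 (-Real.log 4)
    have := hyP (-Real.log 4)
    rw [hP4, zero_mul] at this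
    simp only [hy, h4] at this
    exact hw4 (by linarith)
  · rw [hA0]
    have := Real.arctan_pos.2 hqpos
    have := Real.arctan_lt_pi_div_two q
    constructor <;> linarith

namespace IsSeparatrix

variable {g w A : ℝ → ℝ}

theorem mul_eq_zero_iff (h : IsSeparatrix g w A) (t : ℝ) :
    Real.exp (-t) * g (Real.exp (-t)) = 0 ↔ ∃ m : ℤ, A t = 2 * m * Real.pi := by
  obtain ⟨P, hP, hs, -⟩ := h.exists_radius t
  rw [hs, mul_eq_zero, or_iff_right hP, Real.sin_eq_zero_iff]
  exact exists_congr fun m => ⟨fun e => by linarith, fun e => by linarith⟩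

theorem snd_eq_zero_iff (h : IsSeparatrix g w A) (t : ℝ) :
    w (Real.exp (-t)) = 0 ↔ ∃ m : ℤ, A t = (2 * m + 1) * Real.pi := by
  obtain ⟨P, hP, -, hc⟩ := h.exists_radius t
  rw [← mul_eq_zero_iff_left (two_ne_zero' ℝ), hc, mul_eq_zero, or_iff_right hP,
    Real.cos_eq_zero_iff]
  exact exists_congr fun m => ⟨fun e => by linarith, fun e => by linarith⟩

theorem fst_ne_zero_or (h : IsSeparatrix g w A) {r : ℝ} (hr : 0 < r) : r * g r ≠ 0 ∨ w r ≠ 0 := by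
  obtain ⟨P, hP, hs, hc⟩ := h.exists_radius (-Real.log r)
  rw [neg_neg, Real.exp_log hr] at hs hc
  by_contra! h0
  rw [h0.1, eq_comm, mul_eq_zero, or_iff_right hP] at hs
  rw [h0.2, mul_zero, eq_comm, mul_eq_zero, or_iff_right hP] at hc
  have := Real.sin_sq_add_cos_sq (A (-Real.log r) / 2)
  rw [hs, hc] at this
  norm_num at this

theorem continuous (h : IsSeparatrix g w A) : Continuous A :=
  continuous_iff_continuousAt.2 fun t => (h.isPhase t).continuousAt

theorem mem_Ioo (h : IsSeparatrix g w A) (hg : IsCoulombPair g w) (hw : w 0 = 1) {t : ℝ}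
    (ht : -Real.log 4 ≤ t) : A t ∈ Set.Ioo 0 Real.pi := by
  have hsin : ∀ s, -Real.log 4 ≤ s → Real.sin (A s) ≠ 0 := by
    intro s hs h0
    obtain ⟨P, hP, hs', hc⟩ := h.exists_radius s
    have hr4 : Real.exp (-s) ≤ 4 := by
      rw [← Real.le_log_iff_exp_le (by norm_num)]
      linarith
    have hpos := hg.mul_pos_of_le_four hw (Real.exp_pos (-s)) hr4
    have h2 : Real.sin (A s) = 2 * Real.sin (A s / 2) * Real.cos (A s / 2) := by
      rw [← Real.sin_two_mul, mul_div_cancel₀ _ (two_ne_zero' ℝ)]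
    have : 2 * (Real.exp (-s) * g (Real.exp (-s)) * w (Real.exp (-s)))
        = P ^ 2 / 2 * Real.sin (A s) := by
      rw [h2]
      linear_combination (2 * w (Real.exp (-s))) * hs' + P * Real.sin (A s / 2) * hc
    rw [h0, mul_zero] at this
    linarith
  have h4 := h.mem_Ioo_log_four
  constructor
  · by_contra! hle
    obtain ⟨s, hs, hs0⟩ := intermediate_value_Icc' ht h.continuous.continuousOn
      (show (0 : ℝ) ∈ Set.Icc (A t) (A (-Real.log 4)) from ⟨hle, h4.1.le⟩)
    exact hsin s hs.1 (by rw [hs0, Real.sin_zero])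
  · by_contra! hle
    obtain ⟨s, hs, hs0⟩ := intermediate_value_Icc ht h.continuous.continuousOn
      (show Real.pi ∈ Set.Icc (A (-Real.log 4)) (A t) from ⟨h4.2.le, hle⟩)
    exact hsin s hs.1 (by rw [hs0, Real.sin_pi])

/-- For `r > 4` the potential term exceeds the maximum `4` of `2 - 2 cos`. -/
theorem strictAntiOn (h : IsSeparatrix g w A) : StrictAntiOn A (Set.Iic (-Real.log 4)) := by
  refine strictAntiOn_of_hasDerivWithinAt_neg (convex_Iic _) h.continuous.continuousOn
    (fun t _ => (h.isPhase t).hasDerivWithinAt) fun t ht => ?_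
  rw [interior_Iic, Set.mem_Iio, lt_neg, Real.log_lt_iff_lt_exp (by norm_num)] at ht
  rw [phaseField]
  linarith [Real.neg_one_le_cos (A t)]

theorem pos (h : IsSeparatrix g w A) (hg : IsCoulombPair g w) (hw : w 0 = 1) (t : ℝ) :
    0 < A t := by
  rcases le_total (-Real.log 4) t with ht | ht
  · exact (h.mem_Ioo hg hw ht).1
  · exact h.mem_Ioo_log_four.1.trans_le (h.strictAntiOn.antitoneOn ht Set.self_mem_Iic ht)

theorem tendsto_atBot (h : IsSeparatrix g w A) : Tendsto A atBot atTop := by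
  have hanti : AntitoneOn (fun t => A t + t) (Set.Iic (-Real.log 5)) := by
    refine antitoneOn_of_hasDerivWithinAt_nonpos (convex_Iic _)
      (h.continuous.add continuous_id).continuousOn
      (fun t _ => ((h.isPhase t).add (hasDerivAt_id t)).hasDerivWithinAt) fun t ht => ?_
    rw [interior_Iic, Set.mem_Iio, lt_neg, Real.log_lt_iff_lt_exp (by norm_num)] at ht
    rw [phaseField]
    linarith [Real.neg_one_le_cos (A t)]
  have h1 : Tendsto (fun t : ℝ => A (-Real.log 5) + -Real.log 5 + -t) atBot atTop :=
    tendsto_atTop_add_const_left _ _ tendsto_neg_atBot_atTop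
  refine tendsto_atTop_mono' _ ?_ h1
  filter_upwards [eventually_le_atBot (-Real.log 5)] with t ht
  have : A (-Real.log 5) + -Real.log 5 ≤ A t + t := hanti ht Set.self_mem_Iic ht
  linarith

/-- Near `r = 0` the angle is `2 arctan(v / (2 v'))`, where `v → 0` and `v' → 1`. -/
theorem tendsto_atTop (h : IsSeparatrix g w A) (hg : IsCoulombPair g w) (hw : w 0 = 1) :
    Tendsto A atTop (𝓝 0) := by
  have hexp : Tendsto (fun t : ℝ => Real.exp (-t)) atTop (𝓝 0) :=
    Real.tendsto_exp_neg_atTop_nhds_zero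
  have hx : Tendsto (fun t : ℝ => Real.exp (-t) * g (Real.exp (-t))) atTop (𝓝 0) := by
    simpa [Function.comp_def] using (hg.hasDerivAt_mul 0).continuousAt.tendsto.comp hexp
  have hy : Tendsto (fun t : ℝ => 2 * w (Real.exp (-t))) atTop (𝓝 2) := by
    simpa [Function.comp_def, hw] using
      ((hg.hasDerivAt_snd 0).continuousAt.tendsto.comp hexp).const_mul 2
  have hlim := ((Real.continuous_arctan.tendsto _).comp (hx.div hy two_ne_zero)).const_mul 2
  simp only [zero_div, Real.arctan_zero, mul_zero] at hlim
  refine hlim.congr' ?_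
  filter_upwards [eventually_ge_atTop (-Real.log 4)] with t ht
  obtain ⟨P, hP, hs, hc⟩ := h.exists_radius t
  have hm := h.mem_Ioo hg hw ht
  simp only [Function.comp, Pi.div_apply]
  rw [hs, hc, mul_div_mul_left _ _ hP, ← Real.tan_eq_sin_div_cos,
    Real.arctan_tan (by linarith [hm.1, Real.pi_pos]) (by linarith [hm.2])]
  ring

end IsSeparatrix

/-! ### The sequence of roots -/

/-- Where the real part `v` of `-i M_{i,1/2}(ir)` or its derivative vanishes, the other one does not,
and the vanishing Wronskian forces the corresponding imaginary part to vanish too. -/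
theorem exists_separatrix_whittaker : ∃ A : ℝ → ℝ,
    IsPhase (fun t => Real.exp (-t)) A ∧
    (∀ t, -Real.log 4 ≤ t → A t < Real.pi) ∧ (∀ t, 0 < A t) ∧
    StrictAntiOn A (Set.Iic (-Real.log 4)) ∧ Tendsto A atBot atTop ∧ Tendsto A atTop (𝓝 0) ∧
    (∀ t, whittakerM Complex.I (1 / 2) (Complex.I * Real.exp (-t)) = 0 ↔
      ∃ m : ℤ, A t = 2 * m * Real.pi) ∧
    ∀ t, deriv (whittakerM Complex.I (1 / 2)) (Complex.I * Real.exp (-t)) = 0 ↔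
      ∃ m : ℤ, A t = (2 * m + 1) * Real.pi := by
  have hg := isCoulombPair_re
  have hw : (whittakerDeriv (Complex.I * (0 : ℝ))).re = 1 := by simp [whittakerDeriv_zero]
  obtain ⟨A, h⟩ := hg.exists_isSeparatrix hw
  have hW : ∀ r : ℝ, r * (whittakerQuot (Complex.I * r)).re * (whittakerDeriv (Complex.I * r)).im
      = r * (whittakerQuot (Complex.I * r)).im * (whittakerDeriv (Complex.I * r)).re :=
    fun r => hg.wronskian_eq_zero isCoulombPair_im r
  refine ⟨A, h.isPhase, fun t ht => (h.mem_Ioo hg hw ht).2, h.pos hg hw,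
    h.strictAntiOn, h.tendsto_atBot, h.tendsto_atTop hg hw, fun t => ?_, fun t => ?_⟩
  · rw [← h.mul_eq_zero_iff, whittakerM_I_half]
    have hr := Real.exp_pos (-t)
    have hne := h.fst_ne_zero_or hr
    have hWr := hW (Real.exp (-t))
    rw [mul_assoc, mul_eq_zero, or_iff_right Complex.I_ne_zero, Complex.ext_iff,
      Complex.re_ofReal_mul, Complex.im_ofReal_mul]
    refine ⟨fun h0 => h0.1, fun h0 => ⟨h0, ?_⟩⟩
    rw [h0, zero_mul, eq_comm, mul_eq_zero] at hWr
    exact hWr.resolve_right (hne.resolve_left (not_not.2 h0))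
  · rw [← h.snd_eq_zero_iff, deriv_whittakerM_I_half]
    have hne := h.fst_ne_zero_or (Real.exp_pos (-t))
    have hWr := hW (Real.exp (-t))
    rw [Complex.ext_iff]
    refine ⟨fun h0 => h0.1, fun h0 => ⟨h0, ?_⟩⟩
    rw [h0, mul_zero, mul_eq_zero] at hWr
    exact hWr.resolve_left (hne.resolve_right (not_not.2 h0))

/-- The roots are the points `r = e^{-t}` at which the separatrix angle is a positive multiple of
`π`; there `t < -log 4`, where the angle is strictly monotone. -/
theorem exists_isWhittakerSequence : ∃ (A : ℝ → ℝ) (Γ : ℕ → ℝ),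
    IsPhase (fun t => Real.exp (-t)) A ∧ (∀ t, 0 < A t) ∧ Tendsto A atTop (𝓝 0) ∧
    IsWhittakerSequence Γ ∧ Tendsto Γ atTop atTop ∧
    ∀ γ, 0 < γ → ∀ k : ℕ, γ ∈ Set.Ico (Γ k) (Γ (k + 1)) →
      A (-Real.log γ) ∈ Set.Ico (k * Real.pi) ((k + 1) * Real.pi) := by
  obtain ⟨A, hA, hlt, hpos, hanti, hbot, htop, hzero, hcrit⟩ := exists_separatrix_whittaker
  have hpi := Real.pi_pos
  have hcont : Continuous A := continuous_iff_continuousAt.2 fun t => (hA t).continuousAt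
  have hmem : ∀ t, Real.pi ≤ A t → t < -Real.log 4 := fun t ht => by
    by_contra! h
    exact (hlt t h).not_ge ht
  have hex : ∀ k : ℕ, ∃ t, A t = (k + 1) * Real.pi := fun k => by
    obtain ⟨s, hs1, hs2⟩ := ((hbot.eventually_ge_atTop ((k + 1) * Real.pi)).and
      (eventually_le_atBot (-Real.log 4))).exists
    have h1 : A (-Real.log 4) ≤ (k + 1) * Real.pi := by
      have : (0 : ℝ) ≤ k * Real.pi := by positivity
      linarith [hlt _ le_rfl]
    obtain ⟨t, -, ht⟩ := intermediate_value_Icc' hs2 hcont.continuousOn ⟨h1, hs1⟩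
    exact ⟨t, ht⟩
  choose τ hτ using hex
  have hge : ∀ k : ℕ, Real.pi ≤ A (τ k) := fun k => by
    have : (0 : ℝ) ≤ k * Real.pi := by positivity
    rw [hτ]
    linarith
  have hτ4 : ∀ k, τ k ∈ Set.Iic (-Real.log 4) := fun k => (hmem _ (hge k)).le
  have huniq : ∀ (k : ℕ) (t : ℝ), A t = (k + 1) * Real.pi → t = τ k := fun k t ht =>
    hanti.injOn (hmem t (by rw [ht, ← hτ]; exact hge k)).le (hτ4 k) (ht.trans (hτ k).symm)
  set Γ : ℕ → ℝ := fun k => k.casesOn 0 fun k => Real.exp (-τ k) with hΓ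
  have hΓs : ∀ k, Γ (k + 1) = Real.exp (-τ k) := fun k => rfl
  have hmono : StrictMono Γ := by
    refine strictMono_nat_of_lt_succ fun k => ?_
    rcases k with _ | k
    · exact Real.exp_pos _
    · rw [hΓs, hΓs, Real.exp_lt_exp, neg_lt_neg_iff, ← hanti.lt_iff_gt (hτ4 _) (hτ4 _), hτ, hτ]
      push_cast
      linarith
  have hrange : ∀ (p : ℝ → Prop) (f : ℕ → ℕ),
      (∀ t, p (Real.exp (-t)) ↔ ∃ k : ℕ, A t = (f k + 1) * Real.pi) →
      Set.range (fun k => Γ (f k + 1)) = {r | 0 < r ∧ p r} := by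
    intro p f hp
    ext r
    constructor
    · rintro ⟨k, rfl⟩
      exact ⟨Real.exp_pos _, (hp _).2 ⟨k, hτ _⟩⟩
    · rintro ⟨hr, hpr⟩
      rw [← Real.exp_log hr, ← neg_neg (Real.log r)] at hpr
      obtain ⟨k, hk⟩ := (hp _).1 hpr
      exact ⟨k, by beta_reduce; rw [hΓs, ← huniq _ _ hk, neg_neg, Real.exp_log hr]⟩
  refine ⟨A, Γ, hA, hpos, htop, ⟨rfl, hmono, ?_, ?_⟩, ?_, ?_⟩
  · refine hrange (fun r => deriv (whittakerM Complex.I (1 / 2)) (Complex.I * r) = 0)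
      (fun k => 2 * k) fun t => (hcrit t).trans ⟨?_, ?_⟩
    · rintro ⟨m, hm⟩
      have h1 : 0 < (2 * m + 1 : ℝ) := pos_of_mul_pos_left (hm ▸ hpos t) hpi.le
      have h2 : 0 ≤ m := by
        have : 0 < 2 * m + 1 := by exact_mod_cast h1
        omega
      lift m to ℕ using h2
      exact ⟨m, by rw [hm]; push_cast; ring⟩
    · rintro ⟨k, hk⟩
      exact ⟨k, by rw [hk]; push_cast; ring⟩
  · refine hrange (fun r => whittakerM Complex.I (1 / 2) (Complex.I * r) = 0)
      (fun k => 2 * k + 1) fun t => (hzero t).trans ⟨?_, ?_⟩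
    · rintro ⟨m, hm⟩
      have h1 : 0 < (2 * m : ℝ) := pos_of_mul_pos_left (hm ▸ hpos t) hpi.le
      have h2 : 1 ≤ m := by
        have : 0 < 2 * m := by exact_mod_cast h1
        omega
      obtain ⟨k, rfl⟩ := Int.eq_ofNat_of_zero_le (sub_nonneg.2 h2) |>.imp
        fun k hk => (sub_eq_iff_eq_add.1 hk)
      exact ⟨k, by rw [hm]; push_cast; ring⟩
    · rintro ⟨k, hk⟩
      exact ⟨k + 1, by rw [hk]; push_cast; ring⟩
  · refine tendsto_atTop_atTop_of_monotone hmono.monotone fun b => ?_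
    set B := max b 4 with hB
    have hB4 : 4 ≤ B := le_max_right _ _
    have hB0 : 0 < B := by linarith
    obtain ⟨k, hk⟩ := exists_nat_gt (A (-Real.log B) / Real.pi)
    refine ⟨k + 1, (le_max_left b 4).trans ?_⟩
    rw [div_lt_iff₀ hpi] at hk
    rw [hΓs, ← hB, ← Real.log_le_iff_le_exp hB0, le_neg]
    by_contra! h
    have := hanti.antitoneOn (show -Real.log B ∈ Set.Iic _ from
      neg_le_neg (Real.log_le_log (by norm_num) hB4)) (hτ4 k) h.le
    rw [hτ] at this
    linarith
  · intro γ hγ k hk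
    constructor
    · rcases k with _ | k
      · simpa using (hpos _).le
      · have h1 := hk.1
        rw [hΓs, ← Real.le_log_iff_exp_le hγ, neg_le] at h1
        have := hanti.antitoneOn (Set.mem_Iic.2 (h1.trans (hτ4 k))) (hτ4 k) h1
        rw [hτ] at this
        push_cast
        exact this
    · by_contra! h
      have h1 : Real.pi ≤ A (-Real.log γ) := (hτ k ▸ hge k).trans h
      rw [← hτ, hanti.le_iff_ge (hτ4 k) (hmem _ h1).le] at h
      have h2 := hk.2
      rw [hΓs, ← Real.log_lt_iff_lt_exp hγ] at h2
      linarith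

/-! ### Limits of the angle and winding numbers -/

/-- The phase potential `γ e^{-|t|}`. -/
noncomputable def screenedPotential (γ t : ℝ) : ℝ := γ * Real.exp (-|t|)

theorem continuous_screenedPotential (γ : ℝ) : Continuous (screenedPotential γ) := by
  unfold screenedPotential
  fun_prop

theorem IsPhase.add_two_pi_mul {h φ : ℝ → ℝ} (hφ : IsPhase h φ) (m : ℤ) :
    IsPhase h fun t => φ t + m * (2 * Real.pi) := fun t => by
  refine ((hφ t).add_const _).congr_deriv ?_
  rw [phaseField, phaseField, Real.cos_add_int_mul_two_pi]

theorem IsPhase.neg_comp_neg {γ : ℝ} {φ : ℝ → ℝ} (hφ : IsPhase (screenedPotential γ) φ) :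
    IsPhase (screenedPotential γ) fun t => -φ (-t) := fun t => by
  refine ((hφ (-t)).comp t (hasDerivAt_neg t)).neg.congr_deriv ?_
  rw [phaseField, phaseField, Real.cos_neg, screenedPotential, screenedPotential, abs_neg]
  ring

section Limits

variable {A : ℝ → ℝ} {γ : ℝ} {φ : ℝ → ℝ}

/-- `φ` converges to `2πn` if `φ(0)` lies above the `(n - 1)`-st translate of the separatrix by `2π`
and not above the `n`-th. -/
theorem IsPhase.tendsto_atTop (hA : IsPhase (fun t => Real.exp (-t)) A) (hpos : ∀ t, 0 < A t)
    (hA0 : Tendsto A atTop (𝓝 0)) (hγ : 0 < γ) (hφ : IsPhase (screenedPotential γ) φ) :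
    Tendsto φ atTop (𝓝 (⌈(φ 0 - A (-Real.log γ)) / (2 * Real.pi)⌉ * (2 * Real.pi))) := by
  set n := ⌈(φ 0 - A (-Real.log γ)) / (2 * Real.pi)⌉ with hn
  have hpi := Real.two_pi_pos
  -- Shifting time by `log γ` turns `γ e^{-t}` into `e^{-t}`.
  have hχ : ∀ s ≥ -Real.log γ, HasDerivAt (fun s => φ (s + Real.log γ) + (-n : ℤ) * (2 * Real.pi))
      (phaseField (fun t => Real.exp (-t)) s (φ (s + Real.log γ) + (-n : ℤ) * (2 * Real.pi))) s := by
    intro s hs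
    refine ((hφ.add_two_pi_mul (-n) (s + Real.log γ)).comp_add_const s (Real.log γ)).congr_deriv ?_
    rw [phaseField, phaseField, screenedPotential, abs_of_nonneg (by linarith), neg_add,
      Real.exp_add, Real.exp_neg (Real.log γ), Real.exp_log hγ]
    field_simp
  have h1 : (φ 0 - A (-Real.log γ)) / (2 * Real.pi) ≤ n := Int.le_ceil _
  have h2 : (n : ℝ) < (φ 0 - A (-Real.log γ)) / (2 * Real.pi) + 1 := Int.ceil_lt_add_one _
  rw [div_le_iff₀ hpi] at h1
  rw [← sub_lt_iff_lt_add, lt_div_iff₀ hpi] at h2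
  have key := tendsto_zero_of_phase_between hχ (fun t _ => hA t) (fun t _ => hpos t) hA0
    (by simp only [neg_add_cancel]; push_cast; linarith)
    (by simp only [neg_add_cancel]; push_cast; linarith)
  have h3 := (key.comp (tendsto_atTop_add_const_right _ (-Real.log γ) tendsto_id)).add_const
    (n * (2 * Real.pi))
  simpa [Function.comp_def] using h3

theorem IsPhase.tendsto_atBot (hA : IsPhase (fun t => Real.exp (-t)) A) (hpos : ∀ t, 0 < A t)
    (hA0 : Tendsto A atTop (𝓝 0)) (hγ : 0 < γ) (hφ : IsPhase (screenedPotential γ) φ) :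
    Tendsto φ atBot (𝓝 (⌊(φ 0 + A (-Real.log γ)) / (2 * Real.pi)⌋ * (2 * Real.pi))) := by
  have h := ((hA.tendsto_atTop hpos hA0 hγ hφ.neg_comp_neg).comp tendsto_neg_atBot_atTop).neg
  have e : (-φ (-0) - A (-Real.log γ)) / (2 * Real.pi)
      = -((φ 0 + A (-Real.log γ)) / (2 * Real.pi)) := by rw [neg_zero]; ring
  rw [e, Int.ceil_neg] at h
  simpa [Function.comp_def] using h

end Limits

/-! ### Trajectories on the cylinder -/

/-- The trajectory `z = arctan t`, `Θ = π + φ(t)` in the strip. -/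
noncomputable def phaseLift (φ : ℝ → ℝ) (t : ℝ) : ℝ × ℝ := (Real.arctan t, Real.pi + φ t)

theorem screening_arctan (t : ℝ) : screening (Real.arctan t) = Real.exp (-|t|) := by
  rw [screening, if_neg (Real.cos_arctan_pos t).ne', Real.tan_arctan]

theorem vectorField_phaseLift (γ : ℝ) (φ : ℝ → ℝ) (t : ℝ) :
    vectorField (-1) γ (phaseLift φ t) =
      (1 / (1 + t ^ 2), phaseField (screenedPotential γ) t (φ t)) := by
  simp only [vectorField, phaseLift, screening_arctan, Real.cos_sq_arctan, phaseField,
    screenedPotential, add_comm Real.pi, Real.cos_add_pi]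
  congr 1
  ring

theorem isEquilibrium_of_cos_eq_zero (γ : ℝ) {z : ℝ} (n : ℤ)
    (hz : z ∈ Set.Icc (-(Real.pi / 2)) (Real.pi / 2)) (hcos : Real.cos z = 0) :
    IsEquilibrium (-1) γ (z, Real.pi + n * (2 * Real.pi)) := by
  refine ⟨⟨hz, trivial⟩, ?_⟩
  simp [vectorField, hcos, screening, Real.cos_add_int_mul_two_pi]

theorem isHeteroclinicTrajectory_phaseLift {γ : ℝ} {φ : ℝ → ℝ}
    (hφ : IsPhase (screenedPotential γ) φ) {m n : ℤ}
    (hm : Tendsto φ atBot (𝓝 (m * (2 * Real.pi)))) (hn : Tendsto φ atTop (𝓝 (n * (2 * Real.pi)))) :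
    IsHeteroclinicTrajectory (-1) γ (phaseLift φ) := by
  have hpi := Real.pi_pos
  refine ⟨fun t => ⟨⟨⟨(Real.neg_pi_div_two_lt_arctan t).le, (Real.arctan_lt_pi_div_two t).le⟩,
      trivial⟩, ?_⟩, (-(Real.pi / 2), Real.pi + m * (2 * Real.pi)),
    (Real.pi / 2, Real.pi + n * (2 * Real.pi)),
    isEquilibrium_of_cos_eq_zero γ m ⟨le_rfl, by linarith⟩ (by simp),
    isEquilibrium_of_cos_eq_zero γ n ⟨by linarith, le_rfl⟩ (by simp), fun h => ?_, ?_, ?_⟩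
  · rw [vectorField_phaseLift]
    exact (Real.hasDerivAt_arctan t).prodMk ((hφ t).const_add _)
  · have := congrArg Prod.fst h
    simp only [toCylinder] at this
    linarith
  · exact (Real.tendsto_arctan_atBot.mono_right nhdsWithin_le_nhds).prodMk_nhds (hm.const_add _)
  · exact (Real.tendsto_arctan_atTop.mono_right nhdsWithin_le_nhds).prodMk_nhds (hn.const_add _)

theorem IsEquilibrium.toCylinder_eq {γ : ℝ} {p : ℝ × ℝ} (hp : IsEquilibrium (-1) γ p) :
    toCylinder p = (p.1, (Real.pi : Real.Angle)) := by
  have h1 : Real.cos p.1 = 0 := by simpa [vectorField] using congrArg Prod.fst hp.2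
  have h2 : Real.cos p.2 = -1 := by
    have := congrArg Prod.snd hp.2
    simp only [vectorField, screening, h1, if_true, Prod.snd_zero] at this
    linarith
  obtain ⟨k, hk⟩ := Real.cos_eq_neg_one_iff.1 h2
  rw [toCylinder, ← hk]
  congr 1
  exact Real.Angle.angle_eq_iff_two_pi_dvd_sub.2 ⟨k, by ring⟩

/-- Heteroclinic trajectories lie in the interior of the strip: the boundary circles carry a single
equilibrium each. In the interior `tan z` is time, up to a shift. -/
theorem IsHeteroclinicTrajectory.exists_phase {γ : ℝ} {x : ℝ → ℝ × ℝ}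
    (hx : IsHeteroclinicTrajectory (-1) γ x) :
    ∃ (φ : ℝ → ℝ) (c : ℝ), IsPhase (screenedPotential γ) φ ∧ ∀ τ, x τ = phaseLift φ (τ + c) := by
  obtain ⟨hT, p, q, hp, hq, hpq, hlp, hlq⟩ := hx
  have hz : ∀ τ, HasDerivAt (fun τ => (x τ).1) (Real.cos (x τ).1 ^ 2) τ := fun τ =>
    (ContinuousLinearMap.fst ℝ ℝ ℝ).hasFDerivAt.comp_hasDerivAt τ (hT τ).2
  have hΘ : ∀ τ, HasDerivAt (fun τ => (x τ).2) (vectorField (-1) γ (x τ)).2 τ := fun τ =>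
    (ContinuousLinearMap.snd ℝ ℝ ℝ).hasFDerivAt.comp_hasDerivAt τ (hT τ).2
  have hcos : ∀ τ, Real.cos (x τ).1 ≠ 0 := by
    intro τ₀ h0
    -- `2 z(2 t) + π` solves the phase equation without potential.
    have hsol : IsPhase (fun _ => 0) fun t => 2 * (x (2 * t)).1 + Real.pi := fun t => by
      have := (((hz (2 * t)).comp t ((hasDerivAt_id t).const_mul 2)).const_mul 2).add_const Real.pi
      refine this.congr_deriv ?_
      rw [phaseField, Real.cos_add_pi, Real.cos_two_mul]
      ring
    have hconst : IsPhase (fun _ => 0) fun _ => 2 * (x τ₀).1 + Real.pi := fun t => by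
      refine (hasDerivAt_const t _).congr_deriv ?_
      rw [phaseField, Real.cos_add_pi, Real.cos_two_mul, h0]
      ring
    have heq := hsol.unique hconst (t := τ₀ / 2) (by ring_nf)
    have hzc : ∀ τ, (x τ).1 = (x τ₀).1 := fun τ => by
      have := congrFun heq (τ / 2)
      rw [mul_div_cancel₀ _ (two_ne_zero' ℝ)] at this
      linarith
    have h1 : p.1 = (x τ₀).1 := tendsto_nhds_unique
      ((continuous_fst.tendsto p).comp hlp) (tendsto_const_nhds.congr fun τ => (hzc τ).symm)
    have h2 : q.1 = (x τ₀).1 := tendsto_nhds_unique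
      ((continuous_fst.tendsto q).comp hlq) (tendsto_const_nhds.congr fun τ => (hzc τ).symm)
    exact hpq (by rw [hp.toCylinder_eq, hq.toCylinder_eq, h1, h2])
  have htan : ∀ τ, HasDerivAt (fun τ => Real.tan (x τ).1 - τ) 0 τ := fun τ => by
    have := ((Real.hasDerivAt_tan (hcos τ)).comp τ (hz τ)).sub (hasDerivAt_id τ)
    refine this.congr_deriv ?_
    rw [one_div, inv_mul_cancel₀ (pow_ne_zero 2 (hcos τ)), sub_self]
  set c := Real.tan (x 0).1 with hc
  have hzτ : ∀ τ, (x τ).1 = Real.arctan (τ + c) := fun τ => by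
    have h1 := is_const_of_deriv_eq_zero (fun s => (htan s).differentiableAt)
      (fun s => (htan s).deriv) τ 0
    rw [sub_zero, ← hc, sub_eq_iff_eq_add, add_comm] at h1
    have hs := (hT τ).1.1
    rw [← h1, Real.arctan_tan]
    · refine hs.1.lt_of_ne fun h => hcos τ ?_
      rw [← h, Real.cos_neg, Real.cos_pi_div_two]
    · refine hs.2.lt_of_ne fun h => hcos τ ?_
      rw [h, Real.cos_pi_div_two]
  have hxτ : ∀ τ, x τ = phaseLift (fun t => (x (t - c)).2 - Real.pi) (τ + c) := fun τ => by
    refine Prod.ext (hzτ τ) ?_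
    simp [phaseLift]
  refine ⟨fun t => (x (t - c)).2 - Real.pi, c, fun t => ?_, hxτ⟩
  have h1 := ((hΘ (t - c)).comp_sub_const t c).sub_const Real.pi
  rwa [hxτ (t - c), sub_add_cancel, vectorField_phaseLift] at h1

theorem orbitOf_comp_add (x : ℝ → ℝ × ℝ) (c : ℝ) : orbitOf (fun τ => x (τ + c)) = orbitOf x :=
  (Equiv.addRight c).surjective.range_comp fun τ => toCylinder (x τ)

theorem toCylinder_phaseLift_add_two_pi_mul (φ : ℝ → ℝ) (m : ℤ) (t : ℝ) :
    toCylinder (phaseLift (fun t => φ t + m * (2 * Real.pi)) t) = toCylinder (phaseLift φ t) := by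
  refine Prod.ext rfl (Real.Angle.angle_eq_iff_two_pi_dvd_sub.2 ⟨m, ?_⟩)
  simp only [phaseLift]
  ring

theorem toCylinder_phaseLift_neg (φ : ℝ → ℝ) (t : ℝ) :
    toCylinder (phaseLift (fun t => -φ (-t)) t) =
      (-(toCylinder (phaseLift φ (-t))).1, -(toCylinder (phaseLift φ (-t))).2) := by
  refine Prod.ext (by simp [toCylinder, phaseLift]) ?_
  simp only [toCylinder, phaseLift, ← Real.Angle.coe_neg]
  exact Real.Angle.angle_eq_iff_two_pi_dvd_sub.2 ⟨1, by push_cast; ring⟩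

theorem image_neg_orbitOf_phaseLift (φ : ℝ → ℝ) :
    (fun p : ℝ × Real.Angle => (-p.1, -p.2)) '' orbitOf (phaseLift φ) =
      orbitOf (phaseLift fun t => -φ (-t)) := by
  rw [orbitOf, orbitOf, ← Set.range_comp, ← (Equiv.neg ℝ).surjective.range_comp]
  congr 1
  funext t
  exact (toCylinder_phaseLift_neg φ t).symm

/-- An orbit meets `z = 0` exactly once. -/
theorem zero_mem_orbitOf_phaseLift {φ : ℝ → ℝ} {θ : Real.Angle}
    (h : ((0 : ℝ), θ) ∈ orbitOf (phaseLift φ)) : θ = ((Real.pi + φ 0 : ℝ) : Real.Angle) := by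
  obtain ⟨t, ht⟩ := h
  have h1 : Real.arctan t = 0 := congrArg Prod.fst ht
  rw [Real.arctan_eq_zero_iff] at h1
  subst h1
  exact (congrArg Prod.snd ht).symm

theorem IsPhase.orbitOf_eq {h φ χ : ℝ → ℝ} (hφ : IsPhase h φ) (hχ : IsPhase h χ) {m : ℤ}
    (h0 : φ 0 = χ 0 + m * (2 * Real.pi)) : orbitOf (phaseLift φ) = orbitOf (phaseLift χ) := by
  rw [hφ.unique (hχ.add_two_pi_mul m) h0]
  exact congrArg Set.range (funext (toCylinder_phaseLift_add_two_pi_mul χ m))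

/-- A solution whose initial angle is a multiple of `π` is carried to a lift of the same orbit by
the reflection. -/
theorem IsPhase.isSymmetricOrbit {γ : ℝ} {φ : ℝ → ℝ} (hφ : IsPhase (screenedPotential γ) φ)
    {m : ℤ} (h0 : φ 0 = m * Real.pi) : IsSymmetricOrbit (orbitOf (phaseLift φ)) := by
  rw [IsSymmetricOrbit, image_neg_orbitOf_phaseLift]
  refine hφ.neg_comp_neg.orbitOf_eq hφ (m := -m) ?_
  simp only [neg_zero, h0]
  push_cast
  ring

theorem exists_int_of_isSymmetricOrbit {φ : ℝ → ℝ}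
    (h : IsSymmetricOrbit (orbitOf (phaseLift φ))) : ∃ m : ℤ, φ 0 = m * Real.pi := by
  have hmem : ((0 : ℝ), ((Real.pi + -φ 0 : ℝ) : Real.Angle)) ∈ orbitOf (phaseLift φ) := by
    rw [← h, image_neg_orbitOf_phaseLift]
    exact ⟨0, by simp [toCylinder, phaseLift]⟩
  obtain ⟨m, hm⟩ := Real.Angle.angle_eq_iff_two_pi_dvd_sub.1 (zero_mem_orbitOf_phaseLift hmem)
  exact ⟨-m, by push_cast; linarith⟩

section Orbits

variable {A : ℝ → ℝ} {γ : ℝ}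

theorem isHeteroclinicOrbit_iff (hA : IsPhase (fun t => Real.exp (-t)) A) (hpos : ∀ t, 0 < A t)
    (hA0 : Tendsto A atTop (𝓝 0)) (hγ : 0 < γ) (O : Set (ℝ × Real.Angle)) :
    IsHeteroclinicOrbit (-1) γ O ↔
      ∃ φ, IsPhase (screenedPotential γ) φ ∧ O = orbitOf (phaseLift φ) := by
  constructor
  · rintro ⟨x, hx, rfl⟩
    obtain ⟨φ, c, hφ, h⟩ := hx.exists_phase
    exact ⟨φ, hφ, by rw [funext h, orbitOf_comp_add]⟩
  · rintro ⟨φ, hφ, rfl⟩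
    exact ⟨_, isHeteroclinicTrajectory_phaseLift hφ (hA.tendsto_atBot hpos hA0 hγ hφ)
      (hA.tendsto_atTop hpos hA0 hγ hφ), rfl⟩

/-- Both limits of `φ` are multiples of `2π`, given by the separatrix, so the floor in the definition
of the winding number only removes the factor `2π`. -/
theorem hasWindingNumber_iff (hA : IsPhase (fun t => Real.exp (-t)) A) (hpos : ∀ t, 0 < A t)
    (hA0 : Tendsto A atTop (𝓝 0)) (hγ : 0 < γ) (O : Set (ℝ × Real.Angle)) (N : ℤ) :
    HasWindingNumber (-1) γ O N ↔
      ∃ φ, IsPhase (screenedPotential γ) φ ∧ O = orbitOf (phaseLift φ) ∧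
        N = ⌊(φ 0 + A (-Real.log γ)) / (2 * Real.pi)⌋
          - ⌈(φ 0 - A (-Real.log γ)) / (2 * Real.pi)⌉ := by
  have hfloor : ∀ m n : ℤ, ⌊(Real.pi + m * (2 * Real.pi) - (Real.pi + n * (2 * Real.pi)))
      / (2 * Real.pi)⌋ = m - n := fun m n => by
    have : (Real.pi + m * (2 * Real.pi) - (Real.pi + n * (2 * Real.pi))) / (2 * Real.pi)
        = ((m - n : ℤ) : ℝ) := by
      have := Real.pi_ne_zero
      push_cast
      field_simp
      ring
    rw [this, Int.floor_intCast]
  constructor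
  · rintro ⟨x, hx, rfl, θm, θp, hm, hp, rfl⟩
    obtain ⟨φ, c, hφ, h⟩ := hx.exists_phase
    have h2 : ∀ τ, Real.pi + φ (τ + c) = (x τ).2 := fun τ => by rw [h]; rfl
    have hm' := tendsto_nhds_unique hm ((((hA.tendsto_atBot hpos hA0 hγ hφ).comp
      (tendsto_atBot_add_const_right _ c tendsto_id)).const_add Real.pi).congr h2)
    have hp' := tendsto_nhds_unique hp ((((hA.tendsto_atTop hpos hA0 hγ hφ).comp
      (tendsto_atTop_add_const_right _ c tendsto_id)).const_add Real.pi).congr h2)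
    exact ⟨φ, hφ, by rw [funext h, orbitOf_comp_add], by rw [hm', hp', hfloor]⟩
  · rintro ⟨φ, hφ, rfl, rfl⟩
    have hm := hA.tendsto_atBot hpos hA0 hγ hφ
    have hp := hA.tendsto_atTop hpos hA0 hγ hφ
    exact ⟨_, isHeteroclinicTrajectory_phaseLift hφ hm hp, rfl, _, _, hm.const_add _,
      hp.const_add _, (hfloor _ _).symm⟩

end Orbits

/-- `⌊s + α⌋ - ⌈s - α⌉ + 1` counts the integers in `[s - α, s + α]`, an interval of length `2 α`. -/
theorem floor_sub_ceil_mem {α s : ℝ} {j : ℤ} (h1 : j - 1 ≤ 2 * α) (h2 : 2 * α < j) :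
    ⌊s + α⌋ - ⌈s - α⌉ = j - 2 ∨ ⌊s + α⌋ - ⌈s - α⌉ = j - 1 := by
  have f1 := Int.floor_le (s + α)
  have f2 := Int.lt_floor_add_one (s + α)
  have c1 := Int.le_ceil (s - α)
  have c2 := Int.ceil_lt_add_one (s - α)
  have h3 : ⌊s + α⌋ - ⌈s - α⌉ < j := by
    have : ((⌊s + α⌋ - ⌈s - α⌉ : ℤ) : ℝ) < j := by push_cast; linarith
    exact_mod_cast this
  have h4 : j - 3 < ⌊s + α⌋ - ⌈s - α⌉ := by
    have : ((j - 3 : ℤ) : ℝ) < ((⌊s + α⌋ - ⌈s - α⌉ : ℤ) : ℝ) := by push_cast; linarith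
    exact_mod_cast this
  omega

theorem even_floor_sub_ceil_zero (α : ℝ) : Even (⌊0 + α⌋ - ⌈0 - α⌉) :=
  ⟨⌊α⌋, by rw [zero_add, zero_sub, Int.ceil_neg]; ring⟩

theorem odd_floor_sub_ceil_half (α : ℝ) : Odd (⌊1 / 2 + α⌋ - ⌈1 / 2 - α⌉) := by
  refine ⟨⌊1 / 2 + α⌋ - 1, ?_⟩
  rw [show 1 / 2 - α = -(1 / 2 + α) + 1 by ring, Int.ceil_add_one, Int.ceil_neg]
  ring

theorem mainTheorem3 :
    ∃ Γ : ℕ → ℝ, IsWhittakerSequence Γ ∧ Tendsto Γ atTop atTop ∧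
      ∀ γ : ℝ, 0 < γ → ∀ j : ℕ, 1 ≤ j → γ ∈ Set.Ico (Γ (j - 1)) (Γ j) →
        {N : ℤ | ∃ O : Set (ℝ × Real.Angle), HasWindingNumber (-1) γ O N} =
            {(j : ℤ) - 2, (j : ℤ) - 1} ∧
          ∃ O₁ O₂ : Set (ℝ × Real.Angle), O₁ ≠ O₂ ∧
            {O : Set (ℝ × Real.Angle) | IsHeteroclinicOrbit (-1) γ O ∧ IsSymmetricOrbit O} =
              {O₁, O₂} ∧
            HasWindingNumber (-1) γ O₁ ((j : ℤ) - 2) ∧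
            HasWindingNumber (-1) γ O₂ ((j : ℤ) - 1) := by
  obtain ⟨A, Γ, hA, hpos, hA0, hΓ, hΓtop, hAΓ⟩ := exists_isWhittakerSequence
  refine ⟨Γ, hΓ, hΓtop, fun γ hγ j hj hγj => ?_⟩
  have hpi := Real.pi_pos
  obtain ⟨k, rfl⟩ := Nat.exists_eq_add_of_le' hj
  obtain ⟨ha1, ha2⟩ := hAΓ γ hγ k hγj
  set α := A (-Real.log γ) / (2 * Real.pi) with hα
  have h2α : 2 * α = A (-Real.log γ) / Real.pi := by rw [hα]; field_simp
  have hα1 : (((k + 1 : ℕ) : ℤ) : ℝ) - 1 ≤ 2 * α := by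
    rw [h2α, le_div_iff₀ hpi]
    push_cast
    linarith
  have hα2 : 2 * α < (((k + 1 : ℕ) : ℤ) : ℝ) := by
    rw [h2α, div_lt_iff₀ hpi]
    push_cast
    linarith
  have hW : ∀ O N, HasWindingNumber (-1) γ O N ↔ ∃ φ, IsPhase (screenedPotential γ) φ ∧
      O = orbitOf (phaseLift φ) ∧
      N = ⌊φ 0 / (2 * Real.pi) + α⌋ - ⌈φ 0 / (2 * Real.pi) - α⌉ := fun O N => by
    simp only [hasWindingNumber_iff hA hpos hA0 hγ, hα, add_div, sub_div]
  obtain ⟨φ₀, hφ₀, h0⟩ := exists_isPhase (continuous_screenedPotential γ) 0 0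
  obtain ⟨φ₁, hφ₁, h1⟩ := exists_isPhase (continuous_screenedPotential γ) 0 Real.pi
  have hN₀ : HasWindingNumber (-1) γ (orbitOf (phaseLift φ₀)) (⌊0 + α⌋ - ⌈0 - α⌉) :=
    (hW _ _).2 ⟨φ₀, hφ₀, rfl, by rw [h0, zero_div]⟩
  have hN₁ : HasWindingNumber (-1) γ (orbitOf (phaseLift φ₁)) (⌊1 / 2 + α⌋ - ⌈1 / 2 - α⌉) :=
    (hW _ _).2 ⟨φ₁, hφ₁, rfl, by
      rw [h1, show Real.pi / (2 * Real.pi) = 1 / 2 by field_simp]⟩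
  have hne : orbitOf (phaseLift φ₀) ≠ orbitOf (phaseLift φ₁) := fun he => by
    have hmem : ((0 : ℝ), ((Real.pi + φ₀ 0 : ℝ) : Real.Angle)) ∈ orbitOf (phaseLift φ₁) := by
      rw [← he]
      exact ⟨0, by simp [toCylinder, phaseLift]⟩
    have := zero_mem_orbitOf_phaseLift hmem
    rw [h0, h1, add_zero, Real.Angle.coe_add, Real.Angle.coe_pi_add_coe_pi] at this
    exact Real.Angle.pi_ne_zero this
  have hsym : {O : Set (ℝ × Real.Angle) | IsHeteroclinicOrbit (-1) γ O ∧ IsSymmetricOrbit O} =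
      {orbitOf (phaseLift φ₀), orbitOf (phaseLift φ₁)} := by
    ext O
    simp only [Set.mem_ofPred_eq, Set.mem_insert_iff, Set.mem_singleton_iff,
      isHeteroclinicOrbit_iff hA hpos hA0 hγ]
    constructor
    · rintro ⟨⟨φ, hφ, rfl⟩, hs⟩
      obtain ⟨m, hm⟩ := exists_int_of_isSymmetricOrbit hs
      rcases Int.even_or_odd' m with ⟨l, rfl | rfl⟩
      · exact Or.inl (hφ.orbitOf_eq hφ₀ (m := l) (by rw [hm, h0]; push_cast; ring))
      · exact Or.inr (hφ.orbitOf_eq hφ₁ (m := l) (by rw [hm, h1]; push_cast; ring))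
    · rintro (rfl | rfl)
      · exact ⟨⟨φ₀, hφ₀, rfl⟩, hφ₀.isSymmetricOrbit (m := 0) (by simp [h0])⟩
      · exact ⟨⟨φ₁, hφ₁, rfl⟩, hφ₁.isSymmetricOrbit (m := 1) (by simp [h1])⟩
  -- The two symmetric winding numbers have different parity, so they are `j - 2` and `j - 1`.
  have hex : ∃ O₁ O₂ : Set (ℝ × Real.Angle), O₁ ≠ O₂ ∧
      {O : Set (ℝ × Real.Angle) | IsHeteroclinicOrbit (-1) γ O ∧ IsSymmetricOrbit O} = {O₁, O₂} ∧
      HasWindingNumber (-1) γ O₁ (((k + 1 : ℕ) : ℤ) - 2) ∧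
      HasWindingNumber (-1) γ O₂ (((k + 1 : ℕ) : ℤ) - 1) := by
    have hev := even_floor_sub_ceil_zero α
    have hod := odd_floor_sub_ceil_half α
    rcases floor_sub_ceil_mem (s := 0) hα1 hα2 with e0 | e0 <;>
      rcases floor_sub_ceil_mem (s := 1 / 2) hα1 hα2 with e1 | e1 <;>
      rw [e0] at hev hN₀ <;> rw [e1] at hod hN₁
    · exact absurd hev (Int.not_even_iff_odd.2 hod)
    · exact ⟨_, _, hne, hsym, hN₀, hN₁⟩
    · exact ⟨_, _, hne.symm, hsym.trans (Set.pair_comm _ _), hN₁, hN₀⟩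
    · exact absurd hev (Int.not_even_iff_odd.2 hod)
  refine ⟨?_, hex⟩
  obtain ⟨O₁, O₂, -, -, hO₁, hO₂⟩ := hex
  ext N
  constructor
  · rintro ⟨O, hO⟩
    obtain ⟨φ, -, -, rfl⟩ := (hW O N).1 hO
    exact floor_sub_ceil_mem hα1 hα2
  · rintro (rfl | rfl)
    · exact ⟨O₁, hO₁⟩
    · exact ⟨O₂, hO₂⟩
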